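/- Let $0\le k<n$, let $\mathcal O_n$ be the ring of germs at $0$ of holomorphic functions on $\mathbb C^n$, and let $\Theta_n\cong\mathcal O_n^n$ be the module of germs at $0$ of holomorphic vector fields $\xi=\sum_j\xi_j\,\partial/\partial x_j$. Let $(X,0)$ be an isolated complete intersection singularity (ICIS) of positive dimension $n-k$ determined by $\phi=(\phi_1,\dots,\phi_k):(\mathbb C^n,0)\to(\mathbb C^k,0)$: with $I_X=\langle\phi_1,\dots,\phi_k\rangle\subset\mathcal O_n$, the ring $\mathcal O_n/I_X$ has dimension $n-k$, and $d\phi(x)$ has rank $k$ at every point $x\ne 0$ of $X=\phi^{-1}(0)$ sufficiently close to $0$. Let $$\Theta_X=\{\xi\in\Theta_n : dh(\xi)\in I_X\ \text{for all } h\in I_X\},\qquad \Theta_X^T=\{\xi\in\Theta_n : d\phi(\xi)=0\}+I_X\Theta_n .$$ Let $\omega=\sum_{j=1}^n\omega_j\,dx_j$, $\omega_j\in\mathcal O_n$, be a germ of a holomorphic 1-form, put $\omega(\xi)=\sum_j\omega_j\xi_j$, and assume that $$\mu_{BR}(\omega,X)=\dim_{\mathbb C}\mathcal O_n/\omega(\Theta_X)<\infty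 .$$ Then: 1. If $\xi\in\Theta_X$ and $\omega(\xi)\in I_X$, then $\xi\in\Theta_X^T$. 2. The evaluation map $E:\Theta_X\to\omega(\Theta_X)$, $E(\xi)=\omega(\xi)$, induces an isomorphism of $\mathcal O_n$-modules $$\overline E:\frac{\Theta_X}{\Theta_X^T}\longrightarrow\frac{\omega(\Theta_X)}{\omega(\Theta_X^T)} .$$ -/

import Mathlib

open Filter Topology

noncomputable section

namespace BruceRoberts

/-- The `ℂ`-algebra structure on germs at `0 ∈ ℂⁿ` of complex valued functions. -/
instance germAlgebra (n : ℕ) : Algebra ℂ (Germ (𝓝 (0 : Fin n → ℂ)) ℂ) :=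
  Algebra.ofModule
    (by
      intro r x y
      induction x using Germ.inductionOn with | _ f
      induction y using Germ.inductionOn with | _ g
      exact congrArg Germ.ofFun (smul_mul_assoc r f g))
    (by
      intro r x y
      induction x using Germ.inductionOn with | _ f
      induction y using Germ.inductionOn with | _ g
      exact congrArg Germ.ofFun (mul_smul_comm r f g))

/-- The algebra of germs at `0` of holomorphic functions on `ℂⁿ`, inside all function germs. -/
def holGerms (n : ℕ) : Subalgebra ℂ (Germ (𝓝 (0 : Fin n → ℂ)) ℂ) where
  carrier := {g | ∃ f : (Fin n → ℂ) → ℂ, AnalyticAt ℂ f 0 ∧ (f : Germ (𝓝 (0 : Fin n → ℂ)) ℂ) = g}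
  mul_mem' := by
    rintro _ _ ⟨f, hf, rfl⟩ ⟨g, hg, rfl⟩
    exact ⟨f * g, hf.mul hg, rfl⟩
  add_mem' := by
    rintro _ _ ⟨f, hf, rfl⟩ ⟨g, hg, rfl⟩
    exact ⟨f + g, hf.add hg, rfl⟩
  algebraMap_mem' c := by
    refine ⟨fun _ => c, analyticAt_const, ?_⟩
    rw [Algebra.algebraMap_eq_smul_one]
    change ((fun _ => c : (Fin n → ℂ) → ℂ) : Germ (𝓝 (0 : Fin n → ℂ)) ℂ) =
      ((c • (1 : (Fin n → ℂ) → ℂ) : (Fin n → ℂ) → ℂ) : Germ (𝓝 (0 : Fin n → ℂ)) ℂ)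
    congr 1
    funext x
    simp

/-- The local ring `𝒪ₙ` of germs of holomorphic functions at `0 ∈ ℂⁿ`. -/
def O (n : ℕ) : Type := holGerms n

instance O.instCommRing (n : ℕ) : CommRing (O n) := inferInstanceAs (CommRing (holGerms n))

instance O.instAlgebra (n : ℕ) : Algebra ℂ (O n) := inferInstanceAs (Algebra ℂ (holGerms n))

/-- The partial derivative `∂/∂xⱼ` on function germs. -/
def germPartial {n : ℕ} (j : Fin n) :
    Germ (𝓝 (0 : Fin n → ℂ)) ℂ → Germ (𝓝 (0 : Fin n → ℂ)) ℂ :=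
  Quotient.map' (fun f x => fderiv ℂ f x (Pi.single j 1)) (by
    intro f g (hfg : f =ᶠ[𝓝 0] g)
    change (fun x => fderiv ℂ f x (Pi.single j 1)) =ᶠ[𝓝 0] fun x => fderiv ℂ g x (Pi.single j 1)
    filter_upwards [hfg.fderiv (𝕜 := ℂ)] with x hx
    rw [hx])

theorem germPartial_coe {n : ℕ} (j : Fin n) (f : (Fin n → ℂ) → ℂ) :
    germPartial j (f : Germ (𝓝 (0 : Fin n → ℂ)) ℂ) =
      ((fun x => fderiv ℂ f x (Pi.single j 1) : (Fin n → ℂ) → ℂ) : Germ (𝓝 (0 : Fin n → ℂ)) ℂ) :=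
  rfl

/-- The partial derivative `∂/∂xⱼ : 𝒪ₙ → 𝒪ₙ`. -/
def partialDeriv {n : ℕ} (j : Fin n) (h : O n) : O n :=
  ⟨germPartial j h.1, by
    obtain ⟨_, f, hf, rfl⟩ := h
    exact ⟨fun x => fderiv ℂ f x (Pi.single j 1),
      ((ContinuousLinearMap.apply ℂ ℂ (Pi.single j 1 : Fin n → ℂ)).analyticAt _).comp hf.fderiv,
      rfl⟩⟩

/-- Germs at `0` of holomorphic vector fields on `ℂⁿ`: `ξ` stands for `∑ⱼ ξⱼ ∂/∂xⱼ`. -/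
abbrev VectorField (n : ℕ) : Type := Fin n → O n

/-- Germs at `0` of holomorphic 1-forms on `ℂⁿ`: `ω` stands for `∑ⱼ ωⱼ dxⱼ`. -/
abbrev OneForm (n : ℕ) : Type := Fin n → O n

/-- Evaluation of vector fields by a 1-form, `ξ ↦ ω(ξ) = ∑ⱼ ωⱼ ξⱼ`. -/
def OneForm.eval {n : ℕ} (ω : OneForm n) : VectorField n →ₗ[O n] O n where
  toFun ξ := ∑ j, ω j * ξ j
  map_add' ξ η := by simp [mul_add, Finset.sum_add_distrib]
  map_smul' a ξ := by simp [Finset.mul_sum, mul_left_comm]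

/-- The differential `dh = ∑ⱼ ∂h/∂xⱼ dxⱼ`. -/
def differential {n : ℕ} (h : O n) : OneForm n := fun j => partialDeriv j h

/-- The ideal `I_X = ⟨φ₁, …, φₖ⟩` of the germ `(X, 0)` determined by `φ`. -/
def idealX {n k : ℕ} (φ : Fin k → O n) : Ideal (O n) := Ideal.span (Set.range φ)

/-- `φ` determines an isolated complete intersection singularity: it is a map germ
`(ℂⁿ, 0) → (ℂᵏ, 0)`, the germ `(X, 0)` has dimension `n - k`, and at every point of `X` other than
`0` and close to `0` the map `φ` is a submersion. -/
structure IsICIS {n k : ℕ} (φ : Fin k → O n) : Prop where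
  dim_add : ringKrullDim (O n ⧸ idealX φ) + k = n
  isolated : ∃ f : (Fin n → ℂ) → (Fin k → ℂ),
    (∀ i, ((fun x => f x i : (Fin n → ℂ) → ℂ) : Germ (𝓝 (0 : Fin n → ℂ)) ℂ) = (φ i).1) ∧
    f 0 = 0 ∧
    ∀ᶠ x in 𝓝[≠] (0 : Fin n → ℂ), f x = 0 → Function.Surjective (fderiv ℂ f x)

/-- `Θ_X`, the vector fields tangent to `X`: those `ξ` with `dh(ξ) ∈ I_X` for all `h ∈ I_X`. -/
def logFields {n k : ℕ} (φ : Fin k → O n) : Submodule (O n) (VectorField n) where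
  carrier := {ξ | ∀ h ∈ idealX φ, (differential h).eval ξ ∈ idealX φ}
  zero_mem' h _ := by simp
  add_mem' hξ hη h hh := by
    rw [map_add]
    exact add_mem (hξ h hh) (hη h hh)
  smul_mem' a ξ hξ h hh := by
    rw [map_smul]
    exact Ideal.mul_mem_left _ a (hξ h hh)

/-- `tφ : Θₙ → Θ(φ) = 𝒪ₙᵏ`, `ξ ↦ dφ ∘ ξ`. -/
def tangentMap {n k : ℕ} (φ : Fin k → O n) : VectorField n →ₗ[O n] (Fin k → O n) :=
  LinearMap.pi fun i => (differential (φ i)).eval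

/-- `Θ_X^T = ker tφ + I_X Θₙ`, the trivial vector fields. -/
def trivialFields {n k : ℕ} (φ : Fin k → O n) : Submodule (O n) (VectorField n) :=
  LinearMap.ker (tangentMap φ) ⊔ idealX φ • (⊤ : Submodule (O n) (VectorField n))

/-- The ideal `ω(Θ_X)` of `𝒪ₙ`. -/
def evalLog {n k : ℕ} (ω : OneForm n) (φ : Fin k → O n) : Ideal (O n) :=
  (logFields φ).map ω.eval

/-- The ideal `ω(Θ_X^T)` of `𝒪ₙ`. -/
def evalTrivial {n k : ℕ} (ω : OneForm n) (φ : Fin k → O n) : Ideal (O n) :=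
  (trivialFields φ).map ω.eval

/-- The Bruce-Roberts number `μ_BR(ω, X) = dim_ℂ 𝒪ₙ / ω(Θ_X)`. -/
def bruceRobertsNumber {n k : ℕ} (ω : OneForm n) (φ : Fin k → O n) : ℕ∞ :=
  Cardinal.toENat (Module.rank ℂ (O n ⧸ evalLog ω φ))

theorem partialDeriv_add {n : ℕ} (j : Fin n) (a b : O n) :
    partialDeriv j (a + b) = partialDeriv j a + partialDeriv j b := by
  obtain ⟨_, f, hf, rfl⟩ := a
  obtain ⟨_, g, hg, rfl⟩ := b
  apply Subtype.ext
  refine Quotient.sound' ?_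
  change (fun x => fderiv ℂ (f + g) x (Pi.single j 1)) =ᶠ[𝓝 0]
    (fun x => fderiv ℂ f x (Pi.single j 1)) + fun x => fderiv ℂ g x (Pi.single j 1)
  filter_upwards [hf.eventually_analyticAt, hg.eventually_analyticAt] with x hx hy
  rw [fderiv_add hx.differentiableAt hy.differentiableAt]
  rfl

theorem partialDeriv_mul {n : ℕ} (j : Fin n) (a b : O n) :
    partialDeriv j (a * b) = a * partialDeriv j b + b * partialDeriv j a := by
  obtain ⟨_, f, hf, rfl⟩ := a
  obtain ⟨_, g, hg, rfl⟩ := b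
  apply Subtype.ext
  refine Quotient.sound' ?_
  change (fun x => fderiv ℂ (f * g) x (Pi.single j 1)) =ᶠ[𝓝 0]
    f * (fun x => fderiv ℂ g x (Pi.single j 1)) + g * fun x => fderiv ℂ f x (Pi.single j 1)
  filter_upwards [hf.eventually_analyticAt, hg.eventually_analyticAt] with x hx hy
  rw [fderiv_mul hx.differentiableAt hy.differentiableAt]
  rfl

/-- Trivial vector fields are tangent to `X`, so that `Θ_X / Θ_X^T` makes sense. -/
theorem trivialFields_le_logFields {n k : ℕ} (φ : Fin k → O n) :
    trivialFields φ ≤ logFields φ := by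
  refine sup_le ?_ ?_
  · intro ξ hξ h hh
    rw [LinearMap.mem_ker] at hξ
    have hφ : ∀ i, (differential (φ i)).eval ξ = 0 := fun i => congrFun hξ i
    refine Submodule.span_induction (p := fun h _ => (differential h).eval ξ ∈ idealX φ)
      ?_ ?_ ?_ ?_ hh
    · rintro _ ⟨i, rfl⟩
      rw [hφ i]
      exact zero_mem _
    · have h0 : (differential (0 : O n)).eval ξ = 0 := by
        have h1 : ∀ j : Fin n, partialDeriv j (0 : O n) = 0 := fun j => by
          simpa using partialDeriv_mul j (0 : O n) 0
        simp [differential, OneForm.eval, h1]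
      rw [h0]
      exact zero_mem _
    · intro a b _ _ ha hb
      have h1 : (differential (a + b)).eval ξ =
          (differential a).eval ξ + (differential b).eval ξ := by
        simp [differential, OneForm.eval, partialDeriv_add, add_mul, Finset.sum_add_distrib]
      rw [h1]
      exact add_mem ha hb
    · intro a b hb' hb
      have h1 : (differential (a • b)).eval ξ =
          a * (differential b).eval ξ + (differential a).eval ξ * b := by
        simp only [differential, OneForm.eval, smul_eq_mul, partialDeriv_mul, LinearMap.coe_mk,
          AddHom.coe_mk, Finset.mul_sum, Finset.sum_mul, ← Finset.sum_add_distrib]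
        refine Finset.sum_congr rfl fun j _ => ?_
        ring
      rw [h1]
      exact add_mem (Ideal.mul_mem_left _ a hb) (Ideal.mul_mem_left _ _ hb')
  · refine Submodule.smul_le.2 fun a ha ξ _ h _ => ?_
    rw [map_smul, smul_eq_mul]
    exact Ideal.mul_mem_right _ _ ha

/-- The evaluation map `E : Θ_X → ω(Θ_X)`, `E(ξ) = ω(ξ)`. -/
def evalMap {n k : ℕ} (ω : OneForm n) (φ : Fin k → O n) : logFields φ →ₗ[O n] evalLog ω φ :=
  ω.eval.restrict fun _ hξ => Submodule.mem_map_of_mem hξ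

/-- The map `Ē : Θ_X / Θ_X^T → ω(Θ_X) / ω(Θ_X^T)` induced by `E`. -/
def evalMapBar {n k : ℕ} (ω : OneForm n) (φ : Fin k → O n) :
    (logFields φ ⧸ (trivialFields φ).submoduleOf (logFields φ)) →ₗ[O n]
      (evalLog ω φ ⧸ (evalTrivial ω φ).submoduleOf (evalLog ω φ)) :=
  Submodule.mapQ _ _ (evalMap ω φ) fun _ hξ => Submodule.mem_map_of_mem hξ

end BruceRoberts

end

/-! Let M be the (k+1)×n matrix with rows ω, dφ₁, …, dφₖ. A field ξ in Θ_X with ω(ξ) in I_X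
satisfies Mξ ≡ 0 modulo I_X, so it is a degree-one cycle modulo I_X of the Buchsbaum–Rim complex of
M. If that complex is exact in degree one modulo I_X, then ξ = η + ζ with η in the image of the next
differential and ζ in I_X Θₙ. Then Mη = 0, in particular dφ(η) = 0, which is claim 1. Injectivity of
Ē is claim 1 applied to the difference of ξ and a trivial field with the same value under ω;
surjectivity is clear.

Exactness is a depth count. The complex has length n - k. Mapping cones of φ₁, …, φₖ raise the
length to n and translate exactness modulo I_X into exactness (`Cplx.exactMod_span`). The homology
of the iterated cone is killed by powers of the φᵢ and of the maximal minors of M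
(`buchsbaumRim_kills`, `minor_kills`). Once the radical of the ideal they generate contains the
coordinates, the latter, being a regular sequence of length n on the terms, force the homology to
vanish in positive degrees (`Cplx.exact_of_weaklyRegular`, an acyclicity lemma).

The radical is found geometrically (`coord_mem_radical`). Finite codimension gives xᵢ^N = ω(ξ) with
ξ in Θ_X. At a point x of X with xᵢ ≠ 0, the vector ξ(x) lies in the kernel of dφ(x) while ω does
not vanish on it; as dφ(x) is surjective, M(x) has rank k+1 and some maximal minor is nonzero. So
near 0 the φᵢ and the minors vanish together at most at 0, and Rückert's Nullstellensatz for an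
isolated zero applies (`mem_radical_of_isolated_zero`). That is proved by induction on the number of
variables, through resultants and Weierstrass division; the division theorem itself comes from
inverting an operator on the disc algebra (`weierstrass_division`). -/

noncomputable section

namespace BruceRoberts

/-! ### Weakly regular sequences, mapping cones and the acyclicity lemma. -/

/-- A chain complex of modules in nonnegative degrees. -/
structure Cplx (R : Type) [CommRing R] where
  X : ℕ → Type
  [addCommGroup : ∀ i, AddCommGroup (X i)]
  [module : ∀ i, Module R (X i)]
  d : ∀ i, X (i + 1) →ₗ[R] X i
  d_d : ∀ i x, d i (d (i + 1) x) = 0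

attribute [instance] Cplx.addCommGroup Cplx.module

/-- The elements `y₀, …, y_{e-1}` form a weakly regular sequence on `M`. -/
def WeaklyRegular {R : Type} [CommRing R] (y : ℕ → R) (e : ℕ) (M : Type) [AddCommGroup M]
    [Module R M] : Prop :=
  ∀ i < e, ∀ (m : M) (u : ℕ → M), y i • m = ∑ j ∈ Finset.range i, y j • u j →
    ∃ v : ℕ → M, m = ∑ j ∈ Finset.range i, y j • v j

namespace WeaklyRegular

variable {R : Type} [CommRing R] {y : ℕ → R} {e : ℕ} {M N : Type} [AddCommGroup M] [Module R M]
  [AddCommGroup N] [Module R N]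

theorem pi {ι : Type} {M : ι → Type} [∀ a, AddCommGroup (M a)] [∀ a, Module R (M a)]
    (h : ∀ a, WeaklyRegular y e (M a)) : WeaklyRegular y e (∀ a, M a) := by
  intro i hi m u hu
  have : ∀ a, ∃ v : ℕ → M a, m a = ∑ j ∈ Finset.range i, y j • v j := fun a =>
    h a i hi (m a) (fun j => u j a) (by simpa using congrFun hu a)
  choose v hv using this
  exact ⟨fun j a => v a j, by ext a; simpa using hv a⟩

theorem of_equiv (f : M ≃ₗ[R] N) (h : WeaklyRegular y e M) : WeaklyRegular y e N := by
  intro i hi m u hu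
  obtain ⟨v, hv⟩ := h i hi (f.symm m) (fun j => f.symm (u j)) (by
    simpa using congrArg f.symm hu)
  exact ⟨fun j => f (v j), by simpa using congrArg f hv⟩

theorem prod (hM : WeaklyRegular y e M) (hN : WeaklyRegular y e N) : WeaklyRegular y e (M × N) := by
  intro i hi m u hu
  obtain ⟨v, hv⟩ := hM i hi m.1 (fun j => (u j).1) (by simpa [Prod.fst_sum] using congrArg Prod.fst hu)
  obtain ⟨w, hw⟩ := hN i hi m.2 (fun j => (u j).2) (by simpa [Prod.snd_sum] using congrArg Prod.snd hu)
  exact ⟨fun j => (v j, w j), by ext <;> simpa [Prod.fst_sum, Prod.snd_sum]⟩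

theorem eq_zero_of_smul (h : WeaklyRegular y (e + 1) M) {m : M} (hm : y 0 • m = 0) : m = 0 := by
  obtain ⟨v, hv⟩ := h 0 (by omega) m 0 (by simpa using hm)
  simpa using hv

theorem quotient (h : WeaklyRegular y (e + 1) M) :
    WeaklyRegular (fun j => y (j + 1)) e (M ⧸ LinearMap.range (LinearMap.lsmul R M (y 0))) := by
  intro i hi m u hu
  obtain ⟨m, rfl⟩ := Submodule.mkQ_surjective _ m
  choose u' hu' using fun j => Submodule.mkQ_surjective _ (u j)
  simp only [← hu', ← map_smul, ← map_sum] at hu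
  rw [← sub_eq_zero, ← map_sub, Submodule.mkQ_apply, Submodule.Quotient.mk_eq_zero] at hu
  obtain ⟨t, ht⟩ := hu
  -- A relation modulo `y 0` lifts to one with an extra term `y 0 • t`, and `t` becomes the
  -- coefficient of index 0.
  obtain ⟨v, hv⟩ := h (i + 1) (by omega) m (fun j => Nat.casesOn j t u') (by
    rw [Finset.sum_range_succ']
    simp only [LinearMap.lsmul_apply] at ht
    change _ = ∑ k ∈ Finset.range i, y (k + 1) • u' k + y 0 • t
    rw [ht]; abel)
  refine ⟨fun j => Submodule.mkQ _ (v (j + 1)), ?_⟩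
  simp only [← map_smul, ← map_sum]
  rw [← sub_eq_zero, ← map_sub, Submodule.mkQ_apply, Submodule.Quotient.mk_eq_zero]
  exact ⟨v 0, by rw [hv, Finset.sum_range_succ']; simp⟩

end WeaklyRegular

namespace Cplx

variable {R : Type} [CommRing R]

/-- Multiplication by `a` is zero on the homology of `C`. -/
def Kills (a : R) (C : Cplx R) : Prop :=
  (∀ x : C.X 0, ∃ y, C.d 0 y = a • x) ∧
    ∀ i, ∀ x : C.X (i + 1), C.d i x = 0 → ∃ y, C.d (i + 1) y = a • x

/-- The annihilator of the homology of `C`. -/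
def killer (C : Cplx R) : Ideal R where
  carrier := {a | Kills a C}
  zero_mem' := ⟨fun x => ⟨0, by simp⟩, fun i x _ => ⟨0, by simp⟩⟩
  add_mem' {a b} ha hb := by
    refine ⟨fun x => ?_, fun i x hx => ?_⟩
    · obtain ⟨y, hy⟩ := ha.1 x
      obtain ⟨z, hz⟩ := hb.1 x
      exact ⟨y + z, by rw [map_add, hy, hz, add_smul]⟩
    · obtain ⟨y, hy⟩ := ha.2 i x hx
      obtain ⟨z, hz⟩ := hb.2 i x hx
      exact ⟨y + z, by rw [map_add, hy, hz, add_smul]⟩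
  smul_mem' c a ha := by
    refine ⟨fun x => ?_, fun i x hx => ?_⟩
    · obtain ⟨y, hy⟩ := ha.1 x
      exact ⟨c • y, by rw [map_smul, hy, smul_assoc]⟩
    · obtain ⟨y, hy⟩ := ha.2 i x hx
      exact ⟨c • y, by rw [map_smul, hy, smul_assoc]⟩

theorem mem_killer {C : Cplx R} {a : R} : a ∈ C.killer ↔ Kills a C := Iff.rfl

/-- The complex `C / y C`. -/
def quot (y : R) (C : Cplx R) : Cplx R where
  X i := C.X i ⧸ LinearMap.range (LinearMap.lsmul R (C.X i) y)
  d i := Submodule.mapQ _ _ (C.d i) (by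
    rintro _ ⟨x, rfl⟩
    exact ⟨C.d i x, by simp⟩)
  d_d i x := by
    obtain ⟨x, rfl⟩ := Submodule.mkQ_surjective _ x
    simp [C.d_d]

/-- As y is a nonzerodivisor on the terms, the long exact sequence places the homology of C/yC
between a quotient of H_i(C) and a submodule of H_{i-1}(C). Each is killed by a, hence the square.
-/
theorem quot_kills {y a : R} {C : Cplx R} (hy : ∀ i, ∀ x : C.X i, y • x = 0 → x = 0)
    (h : Kills a C) : Kills (a ^ 2) (quot y C) := by
  refine ⟨fun x => ?_, fun i x hx => ?_⟩
  · obtain ⟨x, rfl⟩ := Submodule.mkQ_surjective _ x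
    obtain ⟨z, hz⟩ := h.1 (a • x)
    refine ⟨Submodule.mkQ _ z, ?_⟩
    change Submodule.mkQ _ (C.d 0 z) = _
    rw [hz, smul_smul, ← sq]
    rfl
  · obtain ⟨x, rfl⟩ := Submodule.mkQ_surjective _ x
    have hx' : Submodule.mkQ (LinearMap.range (LinearMap.lsmul R (C.X i) y)) (C.d i x) = 0 := hx
    rw [Submodule.mkQ_apply, Submodule.Quotient.mk_eq_zero] at hx'
    obtain ⟨u, hu⟩ := hx'
    simp only [LinearMap.lsmul_apply] at hu
    have key : ∃ v, C.d i v = a • u := by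
      match i, x, u, hu with
      | 0, x, u, hu => exact h.1 u
      | i + 1, x, u, hu =>
        refine h.2 i u (hy _ _ ?_)
        rw [← map_smul, hu, C.d_d]
    obtain ⟨v, hv⟩ := key
    obtain ⟨t, ht⟩ := h.2 i (a • x - y • v) (by
      rw [map_sub, map_smul, map_smul, hv, ← hu, smul_comm, sub_self])
    refine ⟨Submodule.mkQ _ t, ?_⟩
    change Submodule.mkQ (LinearMap.range (LinearMap.lsmul R (C.X (i + 1)) y)) (C.d (i + 1) t) =
      Submodule.mkQ _ (a ^ 2 • x)
    rw [ht, ← sub_eq_zero, ← map_sub, Submodule.mkQ_apply,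
      Submodule.Quotient.mk_eq_zero]
    refine ⟨-(a • v), ?_⟩
    simp only [LinearMap.lsmul_apply, smul_sub, smul_neg, sq, mul_smul]
    rw [smul_comm a y v]
    abel

/-- A complex of length `ℓ` whose homology is torsion with respect to a weakly regular sequence of
length `e` has no homology in positive degrees above `ℓ - e`. -/
theorem exact_of_weaklyRegular (e : ℕ) : ∀ (y : ℕ → R) (C : Cplx R) (l : ℕ),
    (∀ i, l < i → Subsingleton (C.X i)) → (∀ i, WeaklyRegular y e (C.X i)) →
    (∀ j < e, ∃ N, Kills (y j ^ N) C) → ∀ i, l < i + 1 + e → ∀ x : C.X (i + 1), C.d i x = 0 →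
    ∃ z, C.d (i + 1) z = x := by
  induction e with
  | zero =>
    intro y C l hl _ _ i hi x _
    have := hl (i + 1) (by omega)
    exact ⟨0, Subsingleton.elim _ _⟩
  | succ e ih =>
    intro y C l hl hreg hk i hi
    have hy : ∀ i, ∀ x : C.X i, y 0 • x = 0 → x = 0 := fun i x => (hreg i).eq_zero_of_smul
    have hq := ih (fun j => y (j + 1)) (quot (y 0) C) l
      (fun i hi => by
        have := hl i hi
        exact (Submodule.mkQ_surjective _).subsingleton)
      (fun i => (hreg i).quotient)
      (fun j hj => by
        obtain ⟨N, hN⟩ := hk (j + 1) (by omega)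
        exact ⟨N * 2, by rw [pow_mul]; exact quot_kills hy hN⟩)
      (i + 1) (by omega)
    -- Multiplication by `y 0` is injective on this homology: if `y 0 • x` is the boundary of t,
    -- then t is a cycle modulo `y 0`, and exactness of the quotient one degree higher moves t by a
    -- boundary to a multiple `y 0 • t'`; cancelling `y 0` gives x as the boundary of t'. Since a
    -- power of `y 0` also kills the homology, it vanishes.
    have step : ∀ x : C.X (i + 1), (∃ z, C.d (i + 1) z = y 0 • x) → ∃ z, C.d (i + 1) z = x := by
      rintro x ⟨t, ht⟩
      obtain ⟨s, hs⟩ := hq (Submodule.mkQ _ t) (by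
        change Submodule.mkQ _ (C.d (i + 1) t) = 0
        rw [Submodule.mkQ_apply, Submodule.Quotient.mk_eq_zero, ht]
        exact ⟨x, rfl⟩)
      obtain ⟨s, rfl⟩ := Submodule.mkQ_surjective _ s
      replace hs : Submodule.mkQ _ (C.d (i + 2) s) = Submodule.mkQ _ t := hs
      rw [eq_comm, ← sub_eq_zero, ← map_sub, Submodule.mkQ_apply,
        Submodule.Quotient.mk_eq_zero] at hs
      obtain ⟨t', ht'⟩ := hs
      simp only [LinearMap.lsmul_apply] at ht'
      refine ⟨t', ?_⟩
      rw [← sub_eq_zero]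
      apply hy
      rw [smul_sub, ← map_smul, ht', map_sub, C.d_d, ht, sub_zero, sub_self]
    intro x hx
    obtain ⟨N, hN⟩ := hk 0 (by omega)
    have : ∀ N, (∃ z, C.d (i + 1) z = y 0 ^ N • x) → ∃ z, C.d (i + 1) z = x := by
      intro N
      induction N with
      | zero => simp
      | succ N ihN =>
        intro h
        refine ihN (step _ ?_)
        rwa [smul_smul, ← pow_succ']
    exact this N (hN.2 i x hx)

/-- The terms of the mapping cone of multiplication by a ring element on `C`. -/
def coneX (C : Cplx R) : ℕ → Type
  | 0 => C.X 0
  | i + 1 => C.X (i + 1) × C.X i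

instance (C : Cplx R) : ∀ i, AddCommGroup (C.coneX i)
  | 0 => inferInstanceAs (AddCommGroup (C.X 0))
  | i + 1 => inferInstanceAs (AddCommGroup (C.X (i + 1) × C.X i))

instance (C : Cplx R) : ∀ i, Module R (C.coneX i)
  | 0 => inferInstanceAs (Module R (C.X 0))
  | i + 1 => inferInstanceAs (Module R (C.X (i + 1) × C.X i))

/-- The differential of the mapping cone of multiplication by `y` on `C`. -/
def coneD (y : R) (C : Cplx R) : ∀ i, C.coneX (i + 1) →ₗ[R] C.coneX i
  | 0 => (C.d 0 ∘ₗ LinearMap.fst R _ _ + y • LinearMap.snd R _ _ : C.X 1 × C.X 0 →ₗ[R] C.X 0)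
  | i + 1 => ((C.d (i + 1) ∘ₗ LinearMap.fst R _ _ + y • LinearMap.snd R _ _).prod
      (- C.d i ∘ₗ LinearMap.snd R _ _) :
        C.X (i + 2) × C.X (i + 1) →ₗ[R] C.X (i + 1) × C.X i)

/-- The mapping cone of multiplication by `y` on `C`. -/
def cone (y : R) (C : Cplx R) : Cplx R where
  X := C.coneX
  d := C.coneD y
  d_d
    | 0, x => by
      change C.d 0 (C.d 1 x.1 + y • x.2) + y • (-(C.d 0 x.2)) = 0
      simp [C.d_d]
    | i + 1, x => by
      change ((C.d (i + 1) (C.d (i + 2) x.1 + y • x.2) + y • (-(C.d (i + 1) x.2)),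
        -(C.d i (-(C.d (i + 1) x.2)))) : C.X (i + 1) × C.X i) = 0
      simp [C.d_d]

/-- The map (x₁, x₂) ↦ (0, x₁) is a contracting homotopy for multiplication by y. -/
theorem cone_kills_self (y : R) (C : Cplx R) : Kills y (cone y C) := by
  refine ⟨fun (x : C.X 0) => ⟨((0, x) : C.X 1 × C.X 0), ?_⟩, ?_⟩
  · change C.d 0 0 + y • x = y • x
    simp
  · intro i
    match i with
    | 0 =>
      rintro ⟨x₁, x₂⟩ hx
      refine ⟨((0, x₁) : C.X 2 × C.X 1), ?_⟩
      replace hx : C.d 0 x₁ + y • x₂ = 0 := hx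
      change ((C.d 1 0 + y • x₁, -(C.d 0 x₁)) : C.X 1 × C.X 0) = (y • x₁, y • x₂)
      rw [map_zero, zero_add, neg_eq_of_add_eq_zero_right hx]
    | i + 1 =>
      rintro ⟨x₁, x₂⟩ hx
      refine ⟨((0, x₁) : C.X (i + 3) × C.X (i + 2)), ?_⟩
      replace hx : ((C.d (i + 1) x₁ + y • x₂, -(C.d i x₂)) : C.X (i + 1) × C.X i) = 0 := hx
      replace hx : C.d (i + 1) x₁ + y • x₂ = 0 := congrArg Prod.fst hx
      change ((C.d (i + 2) 0 + y • x₁, -(C.d (i + 1) x₁)) : C.X (i + 2) × C.X (i + 1)) =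
        (y • x₁, y • x₂)
      rw [map_zero, zero_add, neg_eq_of_add_eq_zero_right hx]

/-- The homology of the cone is an extension of a submodule of H_{i-1}(C) by a quotient of H_i(C),
so two factors of a suffice. -/
theorem cone_kills {a : R} (y : R) {C : Cplx R} (h : Kills a C) : Kills (a ^ 2) (cone y C) := by
  have key : ∀ i, ∀ (x : C.X (i + 1)) (v : C.X (i + 1)) (x₂ : C.X i), C.d i x + y • x₂ = 0 →
      C.d i v = a • x₂ → ∃ t, C.d (i + 1) t + y • (-(a • v)) = a ^ 2 • x := by
    intro i x v x₂ hx hv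
    obtain ⟨t, ht⟩ := h.2 i (a • x + y • v) (by
      rw [map_add, map_smul, map_smul, hv, smul_comm y a, ← smul_add, hx, smul_zero])
    refine ⟨t, ?_⟩
    rw [ht, sq, mul_smul, smul_add, smul_neg, smul_comm y a v]
    abel
  have neg : ∀ i, ∀ (v : C.X (i + 1)) (x₂ : C.X i), C.d i v = a • x₂ →
      -(C.d i (-(a • v))) = a ^ 2 • x₂ := by
    intro i v x₂ hv
    rw [map_neg, neg_neg, map_smul, hv, sq, mul_smul]
  refine ⟨fun (x : C.X 0) => ?_, ?_⟩
  · obtain ⟨z, hz⟩ := h.1 (a • x)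
    refine ⟨((z, 0) : C.X 1 × C.X 0), ?_⟩
    change C.d 0 z + y • (0 : C.X 0) = a ^ 2 • x
    rw [hz, smul_zero, add_zero, smul_smul, sq]
  · intro i
    match i with
    | 0 =>
      rintro ⟨x₁, x₂⟩ hx
      obtain ⟨v, hv⟩ := h.1 x₂
      obtain ⟨t, ht⟩ := key 0 x₁ v x₂ hx hv
      exact ⟨((t, -(a • v)) : C.X 2 × C.X 1), Prod.ext ht (neg 0 v x₂ hv)⟩
    | i + 1 =>
      rintro ⟨x₁, x₂⟩ hx
      replace hx : ((C.d (i + 1) x₁ + y • x₂, -(C.d i x₂)) : C.X (i + 1) × C.X i) = 0 := hx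
      obtain ⟨v, hv⟩ := h.2 i x₂ (neg_eq_zero.1 (congrArg Prod.snd hx))
      obtain ⟨t, ht⟩ := key (i + 1) x₁ v x₂ (congrArg Prod.fst hx) hv
      exact ⟨((t, -(a • v)) : C.X (i + 3) × C.X (i + 2)), Prod.ext ht (neg (i + 1) v x₂ hv)⟩

theorem cone_weaklyRegular {s : ℕ → R} {e : ℕ} (y : R) {C : Cplx R}
    (h : ∀ i, WeaklyRegular s e (C.X i)) : ∀ i, WeaklyRegular s e ((cone y C).X i)
  | 0 => h 0
  | i + 1 => (h (i + 1)).prod (h i)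

theorem cone_subsingleton {l : ℕ} (y : R) {C : Cplx R} (h : ∀ i, l < i → Subsingleton (C.X i)) :
    ∀ i, l + 1 < i → Subsingleton ((cone y C).X i)
  | i + 1, hi => by
    have := h (i + 1) (by omega)
    have := h i (by omega)
    exact inferInstanceAs (Subsingleton (C.X (i + 1) × C.X i))

/-- Cycles of degree one modulo an ideal are boundaries modulo that ideal. -/
def ExactMod (C : Cplx R) (I : Ideal R) : Prop :=
  ∀ c : C.X 1, C.d 0 c ∈ I • (⊤ : Submodule R (C.X 0)) →
    ∃ w : C.X 2, c - C.d 1 w ∈ I • (⊤ : Submodule R (C.X 1))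

/-- If dc = u + yb with u in I, then (c, -b) is a cycle of the cone modulo I. The first component of
a boundary of the cone is dw₁ + yw₂, so the generator y is traded for one more cone. -/
theorem exactMod_of_cone {y : R} {C : Cplx R} {I : Ideal R} (h : (cone y C).ExactMod I) :
    C.ExactMod (I ⊔ Ideal.span {y}) := by
  intro c hc
  rw [Submodule.sup_smul, Submodule.mem_sup] at hc
  obtain ⟨u, hu, v, hv, huv⟩ := hc
  rw [Submodule.ideal_span_singleton_smul, Submodule.mem_smul_pointwise_iff_exists] at hv
  obtain ⟨b, -, rfl⟩ := hv
  obtain ⟨w, hw⟩ := h ((c, -b) : C.X 1 × C.X 0) (by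
    change C.d 0 c + y • (-b) ∈ I • (⊤ : Submodule R (C.X 0))
    rw [← huv]
    simpa using hu)
  refine ⟨w.1, ?_⟩
  have h1 := Submodule.mem_map_of_mem (f := LinearMap.fst R (C.X 1) (C.X 0)) hw
  have h2 : c - C.d 1 w.1 - y • w.2 ∈ I • (⊤ : Submodule R (C.X 1)) := by
    have h3 := (Submodule.map_smul'' I ⊤ (LinearMap.fst R (C.X 1) (C.X 0))).le h1
    have h4 : c - (C.d 1 w.1 + y • w.2) ∈ I • (⊤ : Submodule R (C.X 1)) :=
      Submodule.smul_mono le_rfl le_top h3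
    rwa [sub_sub]
  rw [Submodule.sup_smul]
  rw [← sub_add_cancel (c - C.d 1 w.1) (y • w.2)]
  exact add_mem (Submodule.mem_sup_left h2) (Submodule.mem_sup_right
    (Submodule.smul_mem_smul (Ideal.mem_span_singleton_self y) trivial))

/-- If `s` is weakly regular of length `l + k` on the terms of a complex of length `l`, and its
members are nilpotent modulo the annihilator of homology and `I = ⟨φ₁, …, φₖ⟩`, then cycles of
degree one modulo `I` are boundaries modulo `I`. -/
theorem exactMod_span {s : ℕ → R} : ∀ (k : ℕ) (φ : Fin k → R) (C : Cplx R) (l : ℕ),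
    (∀ i, l < i → Subsingleton (C.X i)) → (∀ i, WeaklyRegular s (l + k) (C.X i)) →
    (∀ j < l + k, s j ∈ (C.killer ⊔ Ideal.span (Set.range φ)).radical) →
    C.ExactMod (Ideal.span (Set.range φ)) := by
  intro k
  induction k with
  | zero =>
    intro φ C l hl hreg hk c hc
    have h0 : Ideal.span (Set.range φ) = ⊥ := by simp
    rw [h0, Submodule.bot_smul, Submodule.mem_bot] at hc
    rw [h0] at hk
    obtain ⟨w, hw⟩ := exact_of_weaklyRegular l s C l hl hreg
      (fun j hj => by simpa [Ideal.mem_radical_iff, mem_killer] using hk j hj) 0 (by omega) c hc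
    exact ⟨w, by rw [hw, sub_self]; exact zero_mem _⟩
  | succ k ih =>
    intro φ C l hl hreg hk
    have hspan : Ideal.span (Set.range φ) =
        Ideal.span (Set.range (Fin.tail φ)) ⊔ Ideal.span {φ 0} := by
      rw [← Ideal.span_union, Set.union_singleton]
      conv_lhs => rw [← Fin.cons_self_tail φ, Fin.range_cons]
    rw [hspan]
    refine exactMod_of_cone (ih (Fin.tail φ) (cone (φ 0) C) (l + 1)
      (cone_subsingleton _ hl) (cone_weaklyRegular _ fun i => ?_) fun j hj => ?_)
    · rw [add_right_comm]
      exact hreg i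
    -- On passing to the cone, `φ 0` joins the annihilator of the homology, and the old annihilators
    -- survive after squaring.
    · have h1 : C.killer ⊔ Ideal.span (Set.range φ) ≤
          ((cone (φ 0) C).killer ⊔ Ideal.span (Set.range (Fin.tail φ))).radical := by
        rw [hspan]
        refine sup_le ?_ (sup_le (le_sup_right.trans Ideal.le_radical) ?_)
        · intro a ha
          exact ⟨2, Ideal.mem_sup_left (cone_kills _ ha)⟩
        · rw [Ideal.span_singleton_le_iff_mem]
          exact Ideal.le_radical (Ideal.mem_sup_left (cone_kills_self _ _))
      exact (Ideal.radical_mono h1).trans (Ideal.radical_idem _).le (hk j (by omega))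

end Cplx

end BruceRoberts

end

noncomputable section

namespace BruceRoberts

/-! ### Products of anticommuting operators. -/

section Anticommute

variable {S ι : Type} [Ring S]

theorem mul_prod_of_anticommute {x : S} {f : ι → S} : ∀ l : List ι,
    (∀ j ∈ l, x * f j = -(f j * x)) →
    x * (l.map f).prod = (-1 : ℤ) ^ l.length • ((l.map f).prod * x)
  | [], _ => by simp
  | j :: l, h => by
    have ih := mul_prod_of_anticommute l fun i hi => h i (List.mem_cons_of_mem _ hi)
    rw [List.map_cons, List.prod_cons, ← mul_assoc, h j List.mem_cons_self, neg_mul, mul_assoc, ih,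
      List.length_cons, pow_succ', mul_smul, mul_smul_comm, neg_one_smul, mul_assoc]

variable {δ ε : ι → S} (hδ : ∀ i j, δ i * δ j = -(δ j * δ i)) (hδ' : ∀ i, δ i * δ i = 0)

include hδ hδ' in
theorem mul_prod_eq_zero {i : ι} : ∀ l : List ι, i ∈ l → δ i * (l.map δ).prod = 0
  | j :: l, h => by
    rw [List.map_cons, List.prod_cons, ← mul_assoc]
    rcases List.mem_cons.1 h with rfl | h
    · rw [hδ', zero_mul]
    · rw [hδ, neg_mul, mul_assoc, mul_prod_eq_zero l h, mul_zero, neg_zero]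

include hδ hδ' in
theorem prod_mul_eq_zero {i : ι} (l : List ι) (h : i ∈ l) : (l.map δ).prod * δ i = 0 := by
  have h1 := mul_prod_of_anticommute l fun j _ => hδ i j
  rw [mul_prod_eq_zero hδ hδ' l h] at h1
  rcases neg_one_pow_eq_or ℤ l.length with h2 | h2
  · simpa [h2] using h1.symm
  · simpa [h2] using h1.symm

variable (hε : ∀ i j, i ≠ j → δ i * ε j = -(ε j * δ i))

include hε in
-- Moving every contraction to the right costs only signs. This lets the last defect of the Koszul
-- homotopy factor through the total contraction `contrAll`.
theorem prod_mul_prod_eq : ∀ l : List ι, l.Nodup → ∃ s : ℤ,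
    (l.map fun j => ε j * δ j).prod = s • ((l.map ε).prod * (l.map δ).prod)
  | [], _ => ⟨1, by simp⟩
  | j :: l, h => by
    obtain ⟨s, hs⟩ := prod_mul_prod_eq l (List.nodup_cons.1 h).2
    have h1 := mul_prod_of_anticommute (x := δ j) (f := ε) l fun i hi => hε j i (by
      rintro rfl
      exact (List.nodup_cons.1 h).1 hi)
    refine ⟨s * (-1) ^ l.length, ?_⟩
    simp only [List.map_cons, List.prod_cons, hs]
    rw [mul_smul, mul_smul_comm, mul_assoc, mul_assoc, ← mul_assoc (δ j), h1, smul_mul_assoc,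
      mul_smul_comm]
    simp only [mul_assoc]

end Anticommute

/-! ### Contraction and exterior multiplication. -/

section Exterior

variable {R : Type} [CommRing R] {M : Type} [AddCommGroup M] [Module R M]

/-- Interior multiplication by a linear form. -/
def contr (a : Module.Dual R M) : Module.End R (ExteriorAlgebra R M) :=
  CliffordAlgebra.contractLeft (Q := 0) a

/-- Exterior multiplication by a vector. -/
def wedge (v : M) : Module.End R (ExteriorAlgebra R M) :=
  LinearMap.mulLeft R (ExteriorAlgebra.ι R v)

theorem contr_mul_contr (a b : Module.Dual R M) : contr a * contr b = -(contr b * contr a) :=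
  LinearMap.ext fun x => CliffordAlgebra.contractLeft_comm (Q := (0 : QuadraticForm R M)) a b x

theorem contr_mul_self (a : Module.Dual R M) : contr a * contr a = 0 :=
  LinearMap.ext fun x => CliffordAlgebra.contractLeft_contractLeft (Q := (0 : QuadraticForm R M)) a x

theorem contr_mul_wedge (a : Module.Dual R M) (v : M) :
    contr a * wedge v = a v • 1 - wedge v * contr a :=
  LinearMap.ext fun x => CliffordAlgebra.contractLeft_ι_mul (Q := (0 : QuadraticForm R M)) a v x

theorem contr_ι (a : Module.Dual R M) (v : M) :
    contr a (ExteriorAlgebra.ι R v) = algebraMap R _ (a v) :=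
  CliffordAlgebra.contractLeft_ι (0 : QuadraticForm R M) a v

theorem wedge_mem (v : M) {p : ℕ} {x : ExteriorAlgebra R M} (hx : x ∈ ⋀[R]^p M) :
    wedge v x ∈ ⋀[R]^(p + 1) M := by
  rw [ExteriorAlgebra.exteriorPower, pow_succ']
  exact Submodule.mul_mem_mul (LinearMap.mem_range_self _ v) hx

theorem contr_mem (a : Module.Dual R M) : ∀ {p : ℕ} {x : ExteriorAlgebra R M},
    x ∈ ⋀[R]^(p + 1) M → contr a x ∈ ⋀[R]^p M
  | 0, x, hx => by
    rw [zero_add, ExteriorAlgebra.exteriorPower, pow_one] at hx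
    obtain ⟨v, rfl⟩ := hx
    rw [contr_ι, ExteriorAlgebra.exteriorPower, pow_zero]
    exact Submodule.algebraMap_mem _
  | p + 1, x, hx => by
    rw [ExteriorAlgebra.exteriorPower, pow_succ'] at hx
    induction hx using Submodule.mul_induction_on' with
    | mem_mul_mem u hu y hy =>
      obtain ⟨v, rfl⟩ := hu
      have h1 : contr a (ExteriorAlgebra.ι R v * y) =
          a v • y - wedge v (contr a y) := LinearMap.congr_fun (contr_mul_wedge a v) y
      rw [h1]
      exact sub_mem (Submodule.smul_mem _ _ hy) (wedge_mem v (contr_mem a hy))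
    | add x _ y _ hx hy =>
      rw [map_add]
      exact add_mem hx hy

theorem contr_prod_mem {ι : Type} (a : ι → Module.Dual R M) : ∀ (l : List ι) {p : ℕ}
    {x : ExteriorAlgebra R M}, x ∈ ⋀[R]^(l.length + p) M →
    (l.map fun i => contr (a i)).prod x ∈ ⋀[R]^p M
  | [], p, x, hx => by simpa using hx
  | i :: l, p, x, hx => by
    rw [List.map_cons, List.prod_cons, Module.End.mul_apply]
    refine contr_mem _ (contr_prod_mem a l ?_)
    rwa [← add_assoc, add_right_comm]

theorem wedge_prod_mem {ι : Type} (v : ι → M) : ∀ (l : List ι) {p : ℕ}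
    {x : ExteriorAlgebra R M}, x ∈ ⋀[R]^p M →
    (l.map fun i => wedge (v i)).prod x ∈ ⋀[R]^(l.length + p) M
  | [], p, x, hx => by simpa using hx
  | i :: l, p, x, hx => by
    rw [List.map_cons, List.prod_cons, Module.End.mul_apply, List.length_cons, add_right_comm]
    exact wedge_mem _ (wedge_prod_mem v l hx)

/-- `ι` splits on the first exterior power. -/
theorem ι_ιInv {x : ExteriorAlgebra R M} (hx : x ∈ ⋀[R]^1 M) :
    ExteriorAlgebra.ι R (ExteriorAlgebra.ιInv x) = x := by
  rw [ExteriorAlgebra.exteriorPower, pow_one] at hx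
  obtain ⟨v, rfl⟩ := hx
  rw [ExteriorAlgebra.ι_leftInverse]

theorem exteriorPower_eq_bot {n p : ℕ} (h : n < p) : ⋀[R]^p (Fin n → R) = ⊥ := by
  have : IsEmpty (Set.powersetCard (Fin n) p) := by
    rw [← not_nonempty_iff]
    rintro ⟨s, hs⟩
    have h1 := Finset.card_le_univ s
    rw [Fintype.card_fin] at h1
    have h2 : s.card = p := hs
    omega
  have := ((Pi.basisFun R (Fin n)).exteriorPower p).repr.toEquiv.subsingleton
  exact (Submodule.subsingleton_iff_eq_bot).1 this

theorem WeaklyRegular.of_free {y : ℕ → R} {e : ℕ} (h : WeaklyRegular y e R) [Module.Free R M]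
    [Module.Finite R M] : WeaklyRegular y e M :=
  (WeaklyRegular.pi fun _ => h).of_equiv (Module.Free.chooseBasis R M).equivFun.symm

end Exterior

/-! ### Construction of the Buchsbaum–Rim complex. -/

section BuchsbaumRim

variable {R : Type} [CommRing R] {M : Type} [AddCommGroup M] [Module R M] {r : ℕ}
  (a : Fin r → Module.Dual R M)

/-- The Koszul differential on exterior powers tensored with divided powers. -/
def koszulD : Module.End R ((Fin r → ℕ) → ExteriorAlgebra R M) where
  -- `w β` is the coefficient of the divided monomial with exponent β. A dual variable lowers the
  -- exponent of a divided monomial by one without any integer factor.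
  toFun w β := ∑ i, contr (a i) (w (β + Pi.single i 1))
  map_add' w u := by ext β; simp [Finset.sum_add_distrib]
  map_smul' c w := by ext β; simp [Finset.smul_sum]

theorem koszulD_apply (w : (Fin r → ℕ) → ExteriorAlgebra R M) (β : Fin r → ℕ) :
    koszulD a w β = ∑ i, contr (a i) (w (β + Pi.single i 1)) := rfl

/-- The exponent β + eᵢ + eⱼ is symmetric in i and j while the contractions anticommute and square
to zero, so the terms cancel in pairs. -/
theorem koszulD_koszulD (w : (Fin r → ℕ) → ExteriorAlgebra R M) : koszulD a (koszulD a w) = 0 := by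
  ext β
  have h1 : koszulD a (koszulD a w) β = ∑ i, ∑ j, contr (a i) (contr (a j)
      (w (β + Pi.single i 1 + Pi.single j 1))) := by
    simp [koszulD_apply]
  have h2 : koszulD a (koszulD a w) β = ∑ i, ∑ j, if i < j then
      contr (a i) (contr (a j) (w (β + Pi.single i 1 + Pi.single j 1))) +
      contr (a j) (contr (a i) (w (β + Pi.single j 1 + Pi.single i 1))) else 0 := by
    rw [h1]
    set f : Fin r → Fin r → ExteriorAlgebra R M := fun i j => contr (a i) (contr (a j)
      (w (β + Pi.single i 1 + Pi.single j 1))) with hf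
    have hd : ∀ i, f i i = 0 := fun i => LinearMap.congr_fun (contr_mul_self (a i)) _
    have h3 : ∀ i j, f i j = (if i < j then f i j else 0) + (if j < i then f i j else 0) := by
      intro i j
      rcases lt_trichotomy i j with h | h | h
      · simp [h, h.not_gt]
      · subst h; simp [hd]
      · simp [h, h.not_gt]
    change ∑ i, ∑ j, f i j = ∑ i, ∑ j, if i < j then f i j + f j i else 0
    rw [Finset.sum_congr rfl fun i _ => Finset.sum_congr rfl fun j _ => h3 i j]
    simp only [Finset.sum_add_distrib]
    rw [Finset.sum_comm (f := fun i j => if j < i then f i j else 0)]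
    simp only [← Finset.sum_add_distrib]
    refine Finset.sum_congr rfl fun i _ => Finset.sum_congr rfl fun j _ => ?_
    split_ifs <;> simp
  rw [h2]
  refine Finset.sum_eq_zero fun i _ => Finset.sum_eq_zero fun j _ => ?_
  split_ifs
  · rw [add_right_comm β]
    have := LinearMap.congr_fun (contr_mul_contr (a i) (a j))
      (w (β + Pi.single j 1 + Pi.single i 1))
    simp only [Module.End.mul_apply, LinearMap.neg_apply] at this
    rw [this, neg_add_cancel]
  · rfl

/-- The part of divided power degree `q` and exterior degree `r + 1 + q`. -/
def koszulPart (R M : Type) [CommRing R] [AddCommGroup M] [Module R M] (r q : ℕ) :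
    Submodule R ((Fin r → ℕ) → ExteriorAlgebra R M) where
  carrier := {w | ∀ α : Fin r → ℕ, w α ∈ if ∑ i, α i = q then ⋀[R]^(r + 1 + q) M else ⊥}
  add_mem' hw hu α := add_mem (hw α) (hu α)
  zero_mem' _ := zero_mem _
  smul_mem' c _ hw α := Submodule.smul_mem _ c (hw α)

theorem koszulPart_mem {q : ℕ} {w : (Fin r → ℕ) → ExteriorAlgebra R M}
    (hw : w ∈ koszulPart R M r q) {α : Fin r → ℕ} (hα : ∑ i, α i = q) :
    w α ∈ ⋀[R]^(r + 1 + q) M := by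
  have := hw α
  rwa [if_pos hα] at this

theorem koszulPart_eq_zero {q : ℕ} {w : (Fin r → ℕ) → ExteriorAlgebra R M}
    (hw : w ∈ koszulPart R M r q) {α : Fin r → ℕ} (hα : ∑ i, α i ≠ q) : w α = 0 := by
  have := hw α
  rwa [if_neg hα] at this

theorem mem_koszulPart {q : ℕ} {w : (Fin r → ℕ) → ExteriorAlgebra R M}
    (h1 : ∀ α, ∑ i, α i = q → w α ∈ ⋀[R]^(r + 1 + q) M) (h2 : ∀ α, ∑ i, α i ≠ q → w α = 0) :
    w ∈ koszulPart R M r q := by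
  intro α
  split_ifs with h
  · exact h1 α h
  · exact h2 α h

theorem koszulD_mem {q : ℕ} {w : (Fin r → ℕ) → ExteriorAlgebra R M}
    (hw : w ∈ koszulPart R M r (q + 1)) : koszulD a w ∈ koszulPart R M r q := by
  refine mem_koszulPart (fun α hα => ?_) fun α hα => ?_
  · rw [koszulD_apply]
    refine Submodule.sum_mem _ fun i _ => contr_mem (a i) (p := r + 1 + q) (koszulPart_mem hw ?_)
    simp [Finset.sum_add_distrib, hα]
  · rw [koszulD_apply]
    refine Finset.sum_eq_zero fun i _ => ?_
    rw [koszulPart_eq_zero hw, map_zero]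
    simpa [Finset.sum_add_distrib] using hα

theorem koszulD_eq_zero {w : (Fin r → ℕ) → ExteriorAlgebra R M}
    (hw : w ∈ koszulPart R M r 0) : koszulD a w = 0 := by
  ext β
  rw [koszulD_apply]
  refine Finset.sum_eq_zero fun i _ => ?_
  rw [koszulPart_eq_zero hw, map_zero]
  simp [Finset.sum_add_distrib]

/-- The total interior multiplication by all the rows. -/
def contrAll : Module.End R (ExteriorAlgebra R M) :=
  ((List.finRange r).map fun i => contr (a i)).prod

/-- A contraction already present in the product occurs twice, which gives zero. This and its mirror
image make the splice compose to zero with both neighbouring differentials. -/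
theorem contr_contrAll (i : Fin r) (x : ExteriorAlgebra R M) : contr (a i) (contrAll a x) = 0 :=
  LinearMap.congr_fun (mul_prod_eq_zero (fun i j => contr_mul_contr (a i) (a j))
    (fun i => contr_mul_self (a i)) _ (List.mem_finRange i)) x

theorem contrAll_contr (i : Fin r) (x : ExteriorAlgebra R M) : contrAll a (contr (a i) x) = 0 :=
  LinearMap.congr_fun (prod_mul_eq_zero (fun i j => contr_mul_contr (a i) (a j))
    (fun i => contr_mul_self (a i)) _ (List.mem_finRange i)) x

theorem contrAll_mem {x : ExteriorAlgebra R M} {p : ℕ} (hx : x ∈ ⋀[R]^(r + p) M) :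
    contrAll a x ∈ ⋀[R]^p M :=
  contr_prod_mem a _ (by simpa using hx)

/-- The terms of the Buchsbaum-Rim complex. -/
def brX (R M : Type) [CommRing R] [AddCommGroup M] [Module R M] (r : ℕ) : ℕ → Type
  | 0 => Fin r → R
  | 1 => M
  | q + 2 => koszulPart R M r q

instance : ∀ i, AddCommGroup (brX R M r i)
  | 0 => inferInstanceAs (AddCommGroup (Fin r → R))
  | 1 => inferInstanceAs (AddCommGroup M)
  | q + 2 => inferInstanceAs (AddCommGroup (koszulPart R M r q))

instance : ∀ i, Module R (brX R M r i)
  | 0 => inferInstanceAs (Module R (Fin r → R))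
  | 1 => inferInstanceAs (Module R M)
  | q + 2 => inferInstanceAs (Module R (koszulPart R M r q))

/-- The map from the top exterior power to the source in the Buchsbaum-Rim complex. -/
def brSplice : koszulPart R M r 0 →ₗ[R] M :=
  ExteriorAlgebra.ιInv ∘ₗ contrAll a ∘ₗ (LinearMap.proj (0 : Fin r → ℕ) :
    ((Fin r → ℕ) → ExteriorAlgebra R M) →ₗ[R] ExteriorAlgebra R M) ∘ₗ Submodule.subtype _

theorem ι_brSplice (w : koszulPart R M r 0) :
    ExteriorAlgebra.ι R (brSplice a w) = contrAll a (w.1 0) :=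
  ι_ιInv (contrAll_mem a (koszulPart_mem w.2 (by simp)))

theorem apply_brSplice (i : Fin r) (w : koszulPart R M r 0) : a i (brSplice a w) = 0 := by
  apply (ExteriorAlgebra.algebraMap_leftInverse (R := R) M).injective
  rw [← contr_ι, ι_brSplice, contr_contrAll, map_zero]

/-- The differentials of the Buchsbaum-Rim complex. -/
def brD : ∀ i, brX R M r (i + 1) →ₗ[R] brX R M r i
  | 0 => (LinearMap.pi a : M →ₗ[R] Fin r → R)
  | 1 => brSplice a
  | _ + 2 => (koszulD a).restrict fun _ hw => koszulD_mem a hw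

/-- The Buchsbaum-Rim complex of the linear map with rows `a`. -/
def buchsbaumRim : Cplx R where
  X := brX R M r
  d := brD a
  d_d
    | 0, w => funext fun i => apply_brSplice a i w
    | 1, (w : koszulPart R M r 1) => by
      change brSplice a ⟨koszulD a w.1, koszulD_mem a w.2⟩ = 0
      apply (ExteriorAlgebra.ι_leftInverse (R := R) (M := M)).injective
      rw [ι_brSplice, map_zero]
      change contrAll a (∑ i, contr (a i) (w.1 (0 + Pi.single i 1))) = 0
      rw [map_sum]
      exact Finset.sum_eq_zero fun i _ => contrAll_contr a i _
    | _ + 2, w => Subtype.ext (koszulD_koszulD a w.1)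

end BuchsbaumRim

end BruceRoberts

end

noncomputable section

namespace BruceRoberts

/-! ### Annihilation of the Buchsbaum–Rim homology. -/

section BuchsbaumRimHomology

variable {R : Type} [CommRing R] {M : Type} [AddCommGroup M] [Module R M] {r : ℕ}
  (a : Fin r → Module.Dual R M) (v : Fin r → M)

/-- The homotopy in the direction of the `j`-th divided power variable. -/
def koszulH (j : Fin r) : Module.End R ((Fin r → ℕ) → ExteriorAlgebra R M) where
  toFun w α := if α j = 0 then 0 else wedge (v j) (w (α - Pi.single j 1))
  map_add' w u := by ext α; simp only [Pi.add_apply, map_add]; split_ifs <;> simp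
  map_smul' c w := by ext α; simp only [Pi.smul_apply, map_smul]; split_ifs <;> simp

/-- The defect of the homotopy in the direction of the `j`-th divided power variable. -/
def koszulP (j : Fin r) : Module.End R ((Fin r → ℕ) → ExteriorAlgebra R M) where
  toFun w β := if β j = 0 then wedge (v j) (contr (a j) (w β)) else 0
  map_add' w u := by ext α; simp only [Pi.add_apply, map_add]; split_ifs <;> simp
  map_smul' c w := by ext α; simp only [Pi.smul_apply, map_smul]; split_ifs <;> simp

theorem koszulH_apply (j : Fin r) (w : (Fin r → ℕ) → ExteriorAlgebra R M) (α : Fin r → ℕ) :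
    koszulH v j w α = if α j = 0 then 0 else wedge (v j) (w (α - Pi.single j 1)) := rfl

theorem koszulP_apply (j : Fin r) (w : (Fin r → ℕ) → ExteriorAlgebra R M) (α : Fin r → ℕ) :
    koszulP a v j w α = if α j = 0 then wedge (v j) (contr (a j) (w α)) else 0 := rfl

theorem koszulH_mem (j : Fin r) {q : ℕ} {w : (Fin r → ℕ) → ExteriorAlgebra R M}
    (hw : w ∈ koszulPart R M r q) : koszulH v j w ∈ koszulPart R M r (q + 1) := by
  have hs : ∀ α : Fin r → ℕ, α j ≠ 0 → ∑ i, α i = ∑ i, (α - Pi.single j 1 : Fin r → ℕ) i + 1 := by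
    intro α hα
    have h1 : α - Pi.single j 1 + Pi.single j 1 = α := by
      ext i
      by_cases h : i = j
      · subst h; simp; omega
      · simp [h]
    conv_lhs => rw [← h1]
    simp only [Pi.add_apply, Finset.sum_add_distrib]
    simp
  refine mem_koszulPart (fun α hα => ?_) fun α hα => ?_
  · rw [koszulH_apply]
    split_ifs with h
    · exact zero_mem _
    · exact wedge_mem _ (koszulPart_mem hw (by have := hs α h; omega))
  · rw [koszulH_apply]
    split_ifs with h
    · rfl
    · rw [koszulPart_eq_zero hw (by have := hs α h; omega), map_zero]

variable {Δ : R} (hv : ∀ i j, a i (v j) = if i = j then Δ else 0)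

include hv

theorem contr_wedge_same (j : Fin r) (x : ExteriorAlgebra R M) :
    contr (a j) (wedge (v j) x) = Δ • x - wedge (v j) (contr (a j) x) := by
  have := LinearMap.congr_fun (contr_mul_wedge (a j) (v j)) x
  rw [hv, if_pos rfl] at this
  exact this

theorem contr_wedge_ne {i j : Fin r} (h : i ≠ j) :
    contr (a i) * wedge (v j) = -(wedge (v j) * contr (a i)) := by
  rw [contr_mul_wedge, hv, if_neg h, zero_smul, zero_sub]

/-- Since aᵢ(vⱼ) = 0 for i ≠ j, the mixed terms anticommute and cancel; for i = j the contraction of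
vⱼ∧ contributes Δ. Where βⱼ = 0 the exponent cannot be lowered, one half of the identity is missing,
and `koszulP` records it. -/
theorem koszul_homotopy (j : Fin r) (w : (Fin r → ℕ) → ExteriorAlgebra R M) :
    koszulD a (koszulH v j w) + koszulH v j (koszulD a w) + koszulP a v j w = Δ • w := by
  ext β
  simp only [Pi.add_apply, koszulD_apply, koszulH_apply, koszulP_apply, Pi.smul_apply]
  by_cases hβ : β j = 0
  · simp only [hβ, if_true, add_zero]
    rw [Finset.sum_eq_single j]
    · rw [if_neg (by simp), add_tsub_cancel_right, contr_wedge_same a v hv]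
      simp
    · intro i _ hij
      rw [if_pos (by simp [hij.symm]), map_zero]
    · simp
  · simp only [hβ, if_false, add_zero]
    rw [map_sum, ← Finset.sum_add_distrib, Finset.sum_eq_single j]
    · have h1 : β - Pi.single j 1 + Pi.single j 1 = β := by
        ext i
        by_cases h : i = j
        · subst h; simp; omega
        · simp [h]
      rw [if_neg (by simp), add_tsub_cancel_right, contr_wedge_same a v hv, h1]
      simp
    · intro i _ hij
      have h1 : β + Pi.single i 1 - Pi.single j 1 = β - Pi.single j 1 + Pi.single i 1 := by
        ext l
        by_cases h : l = j
        · subst h; simp [hij.symm]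
        · simp [h]
      have h2 := LinearMap.congr_fun (contr_wedge_ne a v hv hij)
        (w (β - Pi.single j 1 + Pi.single i 1))
      simp only [Module.End.mul_apply, LinearMap.neg_apply] at h2
      rw [if_neg (by simp; omega), h1, h2, neg_add_cancel]
    · simp

theorem koszulP_cycle (j : Fin r) {w : (Fin r → ℕ) → ExteriorAlgebra R M}
    (hw : koszulD a w = 0) : koszulD a (koszulP a v j w) = 0 := by
  have h1 := koszul_homotopy a v hv j w
  rw [hw, map_zero, add_zero] at h1
  rw [← eq_sub_iff_add_eq'] at h1
  rw [h1, map_sub, koszulD_koszulD, map_smul, hw, smul_zero, sub_zero]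

omit hv in
theorem koszulP_mem (j : Fin r) {q : ℕ} {w : (Fin r → ℕ) → ExteriorAlgebra R M}
    (hw : w ∈ koszulPart R M r q) : koszulP a v j w ∈ koszulPart R M r q := by
  refine mem_koszulPart (fun α hα => ?_) fun α hα => ?_
  · rw [koszulP_apply]
    split_ifs with h
    · rw [add_right_comm]
      refine wedge_mem (p := r + q) _ (contr_mem _ ?_)
      rw [← add_right_comm]
      exact koszulPart_mem hw hα
    · exact zero_mem _
  · rw [koszulP_apply, koszulPart_eq_zero hw hα]
    simp

/-- Applying the homotopies of several directions in succession replaces a multiple of w, modulo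
boundaries, by a cycle supported where all those exponents vanish. -/
theorem koszulP_prod {q : ℕ} {w : (Fin r → ℕ) → ExteriorAlgebra R M}
    (hw : w ∈ koszulPart R M r q) (hd : koszulD a w = 0) : ∀ l : List (Fin r),
    koszulD a ((l.map (koszulP a v)).prod w) = 0 ∧
    (l.map (koszulP a v)).prod w ∈ koszulPart R M r q ∧
    ∃ z ∈ koszulPart R M r (q + 1),
      Δ ^ l.length • w = koszulD a z + (l.map (koszulP a v)).prod w
  | [] => by simpa [hd, hw] using ⟨0, zero_mem _, by simp⟩
  | j :: l => by
    obtain ⟨h1, h2, z, hz, h3⟩ := koszulP_prod hw hd l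
    simp only [List.map_cons, List.prod_cons, Module.End.mul_apply]
    refine ⟨koszulP_cycle a v hv j h1, koszulP_mem a v j h2,
      Δ • z + koszulH v j ((l.map (koszulP a v)).prod w),
      add_mem (Submodule.smul_mem _ _ hz) (koszulH_mem v j h2), ?_⟩
    have h4 := koszul_homotopy a v hv j ((l.map (koszulP a v)).prod w)
    rw [h1, map_zero, add_zero] at h4
    rw [List.length_cons, pow_succ', mul_smul, h3, smul_add, map_add, map_smul, ← h4, add_assoc]

omit hv in
theorem koszulP_prod_apply (w : (Fin r → ℕ) → ExteriorAlgebra R M) (β : Fin r → ℕ) :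
    ∀ l : List (Fin r), (l.map (koszulP a v)).prod w β =
      if ∀ j ∈ l, β j = 0 then
        ((l.map fun j => wedge (v j) * contr (a j)).prod : Module.End R (ExteriorAlgebra R M)) (w β)
      else 0
  | [] => by simp
  | j :: l => by
    simp only [List.map_cons, List.prod_cons, Module.End.mul_apply]
    rw [koszulP_apply, koszulP_prod_apply w β l]
    simp only [List.forall_mem_cons]
    by_cases h2 : ∀ i ∈ l, β i = 0
    · rw [if_pos h2]
      exact if_congr (and_iff_left h2).symm rfl rfl
    · rw [if_neg h2, map_zero, map_zero, ite_self]
      exact (if_neg fun h => h2 h.2).symm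

/-- After all r directions the defect lives only at β = 0, where up to an integer factor it is a
wedge product applied to the total contraction of `w 0`, and that contraction vanishes. -/
theorem koszul_boundary {q : ℕ} {w : (Fin r → ℕ) → ExteriorAlgebra R M}
    (hw : w ∈ koszulPart R M r q) (hd : koszulD a w = 0) (h0 : contrAll a (w 0) = 0) :
    ∃ z ∈ koszulPart R M r (q + 1), koszulD a z = Δ ^ r • w := by
  obtain ⟨-, -, z, hz, h⟩ := koszulP_prod a v hv hw hd (List.finRange r)
  refine ⟨z, hz, ?_⟩
  have h1 : ((List.finRange r).map (koszulP a v)).prod w = 0 := by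
    ext β
    rw [koszulP_prod_apply]
    split_ifs with hβ
    · have hβ : β = 0 := funext fun j => hβ j (List.mem_finRange j)
      obtain ⟨s, hs⟩ := prod_mul_prod_eq (δ := fun j => contr (a j)) (ε := fun j => wedge (v j))
        (fun i j hij => contr_wedge_ne a v hv hij) (List.finRange r) (List.nodup_finRange r)
      rw [hs, hβ]
      change s • (((List.finRange r).map fun j => wedge (v j)).prod (contrAll a (w 0))) = 0
      rw [h0, map_zero, smul_zero]
    · rfl
  rw [h1, add_zero, List.length_finRange] at h
  exact h.symm

/-- For c in the kernel of all rows, contracting v₁∧…∧vᵣ∧c returns c up to a sign and Δ^r. This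
supplies preimages under the splice in degree one. -/
theorem contr_prod_wedge_prod {c : ExteriorAlgebra R M} (hc : ∀ i, contr (a i) c = 0) :
    ∀ l : List (Fin r), l.Nodup → ∃ s : ℤ, s * s = 1 ∧
      (l.map fun j => contr (a j)).prod ((l.map fun j => wedge (v j)).prod c) =
        s • Δ ^ l.length • c
  | [], _ => ⟨1, by simp⟩
  | j :: l, h => by
    obtain ⟨s, hs, hs'⟩ := contr_prod_wedge_prod hc l (List.nodup_cons.1 h).2
    have h1 := mul_prod_of_anticommute (x := wedge (v j)) (f := fun i => contr (a i)) l
      fun i hi => by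
        rw [contr_wedge_ne a v hv (by rintro rfl; exact (List.nodup_cons.1 h).1 hi), neg_neg]
    have h2 := congrArg (fun y => (-1 : ℤ) ^ l.length • y) h1
    simp only [smul_smul, ← mul_pow] at h2
    have h3 := LinearMap.congr_fun h2.symm ((l.map fun j => wedge (v j)).prod c)
    simp only [mul_neg, mul_one, neg_neg, one_pow, one_smul, Module.End.mul_apply,
      LinearMap.smul_apply] at h3
    refine ⟨(-1) ^ l.length * s, ?_, ?_⟩
    · rw [mul_mul_mul_comm, hs, ← mul_pow]
      simp
    · simp only [List.map_cons, List.prod_cons, Module.End.mul_apply]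
      rw [h3, hs', map_zsmul, map_zsmul, map_zsmul, map_smul, map_smul,
        contr_wedge_same a v hv, hc, map_zero, sub_zero, List.length_cons, pow_succ, mul_smul,
        mul_smul]

/-- The vectors vⱼ form a section of the map up to the factor Δ. Degree zero needs only Δ and the
other degrees Δ^r; the exponent r + 1 serves all of them, including r = 0. -/
theorem buchsbaumRim_kills : Cplx.Kills (Δ ^ (r + 1)) (buchsbaumRim a) := by
  refine ⟨fun (g : Fin r → R) => ⟨(Δ ^ r • ∑ j, g j • v j : M), ?_⟩, fun i => ?_⟩
  · change LinearMap.pi a (Δ ^ r • ∑ j, g j • v j) = Δ ^ (r + 1) • g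
    ext i
    simp [hv, pow_succ]
    ring
  · match i with
    | 0 =>
      intro (c : M) hc
      have hc' : ∀ i, a i c = 0 := fun i => congrFun (hc : LinearMap.pi a c = 0) i
      obtain ⟨s, hs, hs'⟩ := contr_prod_wedge_prod a v hv (c := ExteriorAlgebra.ι R c)
        (fun i => by rw [contr_ι, hc', map_zero]) (List.finRange r) (List.nodup_finRange r)
      set u : ExteriorAlgebra R M := ((List.finRange r).map fun j => wedge (v j)).prod
        (ExteriorAlgebra.ι R c)
      have hu : u ∈ ⋀[R]^(r + 1) M := by
        have := wedge_prod_mem v (List.finRange r) (p := 1) (x := ExteriorAlgebra.ι R c)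
          (by rw [ExteriorAlgebra.exteriorPower, pow_one]; exact LinearMap.mem_range_self _ c)
        rwa [List.length_finRange] at this
      -- The factor s cancels the sign because s * s = 1, and the extra Δ brings the exponent to r +
      -- 1.
      have hw : (Pi.single 0 (Δ • s • u) : (Fin r → ℕ) → ExteriorAlgebra R M) ∈
          koszulPart R M r 0 := by
        refine mem_koszulPart (fun α hα => ?_) fun α hα => ?_
        · have : α = 0 := by
            ext i
            exact Finset.sum_eq_zero_iff.1 hα i (Finset.mem_univ i)
          subst this
          rw [Pi.single_eq_same]
          exact Submodule.smul_mem _ _ (zsmul_mem hu s)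
        · rw [Pi.single_eq_of_ne]
          rintro rfl
          simp at hα
      refine ⟨(⟨_, hw⟩ : koszulPart R M r 0), ?_⟩
      change brSplice a ⟨_, hw⟩ = Δ ^ (r + 1) • c
      apply ExteriorAlgebra.ι_leftInverse (R := R).injective
      rw [ι_brSplice]
      simp only [Pi.single_eq_same]
      rw [map_smul, map_zsmul]
      change Δ • s • (((List.finRange r).map fun j => contr (a j)).prod u) = _
      rw [hs', smul_smul s, hs, one_smul, List.length_finRange, smul_smul, ← pow_succ', map_smul]
    | 1 =>
      rintro (w : koszulPart R M r 0) hw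
      obtain ⟨z, hz, h⟩ := koszul_boundary a v hv w.2 (koszulD_eq_zero a w.2) (by
        rw [← ι_brSplice]
        replace hw : brSplice a w = 0 := hw
        rw [hw, map_zero])
      refine ⟨(⟨Δ • z, Submodule.smul_mem _ _ hz⟩ : koszulPart R M r 1), Subtype.ext ?_⟩
      change koszulD a (Δ • z) = Δ ^ (r + 1) • w.1
      rw [map_smul, h, smul_smul, pow_succ']
    | q + 2 =>
      rintro (w : koszulPart R M r (q + 1)) hw
      obtain ⟨z, hz, h⟩ := koszul_boundary a v hv w.2 (congrArg Subtype.val hw) (by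
        rw [koszulPart_eq_zero w.2 (by simp), map_zero])
      refine ⟨(⟨Δ • z, Submodule.smul_mem _ _ hz⟩ : koszulPart R M r (q + 2)), Subtype.ext ?_⟩
      change koszulD a (Δ • z) = Δ ^ (r + 1) • w.1
      rw [map_smul, h, smul_smul, pow_succ']

end BuchsbaumRimHomology

/-! ### Regularity of the terms and length of the complex. -/

section BuchsbaumRimTerms

variable {R : Type} [CommRing R] {r : ℕ}

theorem koszulPart_weaklyRegular {M : Type} [AddCommGroup M] [Module R M] [Module.Free R M]
    [Module.Finite R M] {s : ℕ → R} {e : ℕ} (h : WeaklyRegular s e R) (q : ℕ) :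
    WeaklyRegular s e (koszulPart R M r q) := by
  classical
  let E : koszulPart R M r q ≃ₗ[R] ({α : Fin r → ℕ // ∑ i, α i = q} → ⋀[R]^(r + 1 + q) M) :=
    { toFun := fun w α => ⟨w.1 α.1, koszulPart_mem w.2 α.2⟩
      map_add' := fun _ _ => rfl
      map_smul' := fun _ _ => rfl
      invFun := fun u => ⟨fun α => if hα : ∑ i, α i = q then (u ⟨α, hα⟩).1 else 0,
        mem_koszulPart (fun α hα => by rw [dif_pos hα]; exact (u ⟨α, hα⟩).2)
          fun α hα => dif_neg hα⟩
      left_inv := fun w => Subtype.ext <| funext fun α => by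
        by_cases hα : ∑ i, α i = q
        · simp [hα]
        · simp [hα, koszulPart_eq_zero w.2 hα]
      right_inv := fun u => funext fun α => Subtype.ext (by simp [α.2]) }
  exact WeaklyRegular.of_equiv E.symm (WeaklyRegular.pi fun _ => h.of_free)

theorem buchsbaumRim_weaklyRegular {n : ℕ} (a : Fin r → Module.Dual R (Fin n → R)) {s : ℕ → R}
    {e : ℕ} (h : WeaklyRegular s e R) : ∀ i, WeaklyRegular s e ((buchsbaumRim a).X i)
  | 0 => WeaklyRegular.pi (M := fun _ : Fin r => R) fun _ => h
  | 1 => WeaklyRegular.pi (M := fun _ : Fin n => R) fun _ => h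
  | q + 2 => koszulPart_weaklyRegular h q

theorem buchsbaumRim_subsingleton {n : ℕ} (a : Fin r → Module.Dual R (Fin n → R)) (hrn : r ≤ n) :
    ∀ i, n - r + 1 < i → Subsingleton ((buchsbaumRim a).X i)
  | 0, hi => by omega
  | 1, hi => by omega
  | q + 2, hi => by
    refine (Submodule.subsingleton_iff_eq_bot (p := koszulPart R (Fin n → R) r q)).2
      (eq_bot_iff.2 fun w hw => ?_)
    ext α
    by_cases hα : ∑ i, α i = q
    · have := koszulPart_mem hw hα
      rwa [exteriorPower_eq_bot (by omega), Submodule.mem_bot] at this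
    · exact koszulPart_eq_zero hw hα

end BuchsbaumRimTerms

end BruceRoberts

end

noncomputable section

namespace BruceRoberts

/-! ### Power series evaluated in a commutative Banach algebra. -/

section FunctionalCalculus

variable {n : ℕ} {A : Type} [NormedCommRing A] [NormedAlgebra ℂ A]

/-- Substitution of elements of a Banach algebra into a power series in `n` variables. -/
def liftSeries (A : Type) [NormedCommRing A] [NormedAlgebra ℂ A]
    (p : FormalMultilinearSeries ℂ (Fin n → ℂ) ℂ) : FormalMultilinearSeries ℂ (Fin n → A) A :=
  fun k => ∑ i : Fin k → Fin n, p k (fun j => Pi.single (i j) 1) •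
    (ContinuousMultilinearMap.mkPiAlgebraFin ℂ k A).compContinuousLinearMap
      fun j => ContinuousLinearMap.proj (i j)

theorem norm_liftSeries_le (p : FormalMultilinearSeries ℂ (Fin n → ℂ) ℂ) (k : ℕ) :
    ‖liftSeries A p k‖ ≤ max 1 ‖(1 : A)‖ * (n ^ k * ‖p k‖) := by
  have h : ∀ i : Fin k → Fin n, ‖p k (fun j => Pi.single (i j) 1) •
      (ContinuousMultilinearMap.mkPiAlgebraFin ℂ k A).compContinuousLinearMap
        fun j => (ContinuousLinearMap.proj (i j) : (Fin n → A) →L[ℂ] A)‖ ≤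
      ‖p k‖ * max 1 ‖(1 : A)‖ := by
    intro i
    rw [norm_smul]
    gcongr
    · refine ((p k).le_opNorm _).trans ?_
      refine mul_le_of_le_one_right (norm_nonneg _) (Finset.prod_le_one (fun _ _ => norm_nonneg _)
        fun j _ => ?_)
      rw [Pi.norm_single, norm_one]
    · refine (ContinuousMultilinearMap.norm_compContinuousLinearMap_le _ _).trans ?_
      refine (mul_le_of_le_one_right (norm_nonneg _) (Finset.prod_le_one (fun _ _ => norm_nonneg _)
        fun j _ => ?_)).trans ContinuousMultilinearMap.norm_mkPiAlgebraFin_le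
      exact ContinuousLinearMap.opNorm_le_bound _ zero_le_one fun x => by
        simpa using norm_le_pi_norm x (i j)
  refine (norm_sum_le_of_le _ fun i _ => h i).trans ?_
  simp only [Finset.sum_const, Finset.card_univ, Fintype.card_fun, Fintype.card_fin, nsmul_eq_mul]
  push_cast
  apply le_of_eq
  ring

theorem liftSeries_radius_pos (p : FormalMultilinearSeries ℂ (Fin n → ℂ) ℂ) (hp : 0 < p.radius) :
    0 < (liftSeries A p).radius := by
  obtain ⟨C, s, hC, hs, h⟩ := p.le_mul_pow_of_radius_pos hp
  have hpos : 0 < ((n + 1) * s : ℝ) := by positivity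
  -- There are n^k words of length k and the coefficients are bounded by C s^k. Using n + 1 in place
  -- of n keeps the inverse meaningful when n = 0.
  let ρ : NNReal := ⟨((n + 1) * s)⁻¹, by positivity⟩
  have hρ : (0 : NNReal) < ρ := by
    rw [← NNReal.coe_pos]
    exact inv_pos.2 hpos
  refine lt_of_lt_of_le (ENNReal.coe_pos.2 hρ)
    (FormalMultilinearSeries.le_radius_of_bound _ (max 1 ‖(1 : A)‖ * C) fun k => ?_)
  have h1 : ((n + 1) * s : ℝ) ^ k * (ρ : ℝ) ^ k = 1 := by
    rw [← mul_pow]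
    change (((n + 1) * s : ℝ) * ((n + 1) * s)⁻¹) ^ k = 1
    rw [mul_inv_cancel₀ hpos.ne', one_pow]
  calc ‖liftSeries A p k‖ * (ρ : ℝ) ^ k
      ≤ max 1 ‖(1 : A)‖ * ((n + 1 : ℝ) ^ k * (C * s ^ k)) * (ρ : ℝ) ^ k := by
        refine mul_le_mul_of_nonneg_right ((norm_liftSeries_le p k).trans ?_) (by positivity)
        gcongr
        · linarith
        · exact h k
    _ = max 1 ‖(1 : A)‖ * C * (((n + 1) * s : ℝ) ^ k * (ρ : ℝ) ^ k) := by
        rw [mul_pow]; ring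
    _ = max 1 ‖(1 : A)‖ * C := by rw [h1, mul_one]

theorem algHom_liftSeries (χ : A →ₐ[ℂ] ℂ) (p : FormalMultilinearSeries ℂ (Fin n → ℂ) ℂ) (k : ℕ)
    (b : Fin n → A) : χ (liftSeries A p k fun _ => b) = p k fun _ j => χ (b j) := by
  have h1 : (fun _ : Fin k => fun j => χ (b j)) =
      fun _ : Fin k => ∑ j, χ (b j) • (Pi.single j 1 : Fin n → ℂ) := by
    ext _ j
    simp [Finset.sum_apply, Pi.single_apply]
  rw [h1, ContinuousMultilinearMap.map_sum]
  simp only [liftSeries, sum_apply, map_sum]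
  refine Finset.sum_congr rfl fun i _ => ?_
  rw [ContinuousMultilinearMap.map_smul_univ (p k) (fun j => χ (b (i j)))
    (fun j => (Pi.single (i j) 1 : Fin n → ℂ))]
  simp [List.prod_ofFn, mul_comm]

/-- Holomorphic functional calculus near the origin. -/
theorem exists_functionalCalculus [CompleteSpace A] {f : (Fin n → ℂ) → ℂ} (hf : AnalyticAt ℂ f 0) :
    ∃ F : (Fin n → A) → A, AnalyticAt ℂ F 0 ∧
      ∀ᶠ b in 𝓝 0, ∀ χ : A →ₐ[ℂ] ℂ, χ (F b) = f fun j => χ (b j) := by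
  obtain ⟨p, ρ, hp⟩ := hf
  have hrad := liftSeries_radius_pos (A := A) p (hp.r_pos.trans_le hp.r_le)
  have hF := (liftSeries A p).hasFPowerSeriesOnBall hrad
  refine ⟨(liftSeries A p).sum, hF.analyticAt, ?_⟩
  have h1 : ∀ᶠ b : Fin n → A in 𝓝 0, b ∈ Metric.eball (0 : Fin n → A) (liftSeries A p).radius :=
    Metric.eball_mem_nhds _ hrad
  obtain ⟨ε, hε, hball⟩ := Metric.mem_nhds_iff.1 (Metric.eball_mem_nhds (0 : Fin n → ℂ) hp.r_pos)
  -- A character satisfies |χ(b)| ≤ ‖b‖‖1‖, so one smallness condition puts the image point in the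
  -- ball of convergence for every χ at once.
  have h2 : ∀ᶠ b : Fin n → A in 𝓝 0, ‖b‖ * ‖(1 : A)‖ < ε := by
    have : Continuous fun b : Fin n → A => ‖b‖ * ‖(1 : A)‖ := by fun_prop
    refine this.continuousAt.eventually_lt continuousAt_const ?_
    simpa using hε
  filter_upwards [h1, h2] with b hb hb' χ
  have h3 : (fun j => χ (b j)) ∈ Metric.eball (0 : Fin n → ℂ) ρ := by
    apply hball
    rw [mem_ball_zero_iff, pi_norm_lt_iff hε]
    intro j
    refine (AlgHom.norm_apply_le_self_mul_norm_one χ (b j)).trans_lt (lt_of_le_of_lt ?_ hb')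
    gcongr
    exact norm_le_pi_norm b j
  have h4 := hF.hasSum hb
  have h5 := hp.hasSum h3
  rw [zero_add] at h4 h5
  replace h4 : HasSum (fun k => χ (liftSeries A p k fun _ => b)) (χ ((liftSeries A p).sum b)) :=
    h4.mapL (AlgHom.toContinuousLinearMap χ)
  simp only [algHom_liftSeries] at h4
  exact h4.unique h5

end FunctionalCalculus

/-! ### The disc algebra and its backward shift. -/

section DiscAlgebra

/-- The closed unit disc. -/
abbrev Disc : Type := Metric.closedBall (0 : ℂ) 1

/-- Extension by zero of a function on the closed disc. -/
def extendZero (f : C(Disc, ℂ)) (z : ℂ) : ℂ :=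
  open Classical in if h : z ∈ Metric.closedBall (0 : ℂ) 1 then f ⟨z, h⟩ else 0

theorem extendZero_coe (f : C(Disc, ℂ)) (w : Disc) : extendZero f w = f w := dif_pos w.2

theorem extendZero_of_mem (f : C(Disc, ℂ)) {z : ℂ} (h : z ∈ Metric.closedBall (0 : ℂ) 1) :
    extendZero f z = f ⟨z, h⟩ := dif_pos h

theorem ball_subset_disc {z : ℂ} (h : z ∈ Metric.ball (0 : ℂ) 1) :
    z ∈ Metric.closedBall (0 : ℂ) 1 := Metric.ball_subset_closedBall h

/-- The disc algebra. -/
def discAlgebra : Subalgebra ℂ C(Disc, ℂ) where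
  carrier := {f | DifferentiableOn ℂ (extendZero f) (Metric.ball 0 1)}
  mul_mem' {f g} hf hg := (DifferentiableOn.mul hf hg).congr fun z hz => by
    simp [extendZero_of_mem _ (ball_subset_disc hz)]
  add_mem' {f g} hf hg := (DifferentiableOn.add hf hg).congr fun z hz => by
    simp [extendZero_of_mem _ (ball_subset_disc hz)]
  algebraMap_mem' c := (differentiableOn_const c).congr fun z hz => by
    simp [extendZero_of_mem _ (ball_subset_disc hz)]

theorem isClosed_discAlgebra : IsClosed (discAlgebra : Set C(Disc, ℂ)) := by
  refine IsSeqClosed.isClosed fun F f hF hf => ?_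
  have h1 := ContinuousMap.tendsto_iff_tendstoUniformly.1 hf
  have h2 : TendstoUniformlyOn (fun k => extendZero (F k)) (extendZero f) atTop
      (Metric.ball (0 : ℂ) 1) := by
    rw [Metric.tendstoUniformlyOn_iff]
    rw [Metric.tendstoUniformly_iff] at h1
    intro ε hε
    filter_upwards [h1 ε hε] with k hk z hz
    rw [extendZero_of_mem _ (ball_subset_disc hz), extendZero_of_mem _ (ball_subset_disc hz)]
    exact hk _
  exact h2.tendstoLocallyUniformlyOn.differentiableOn (Eventually.of_forall hF) Metric.isOpen_ball

/-- The disc algebra, as a Banach algebra. -/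
def DiscAlgebra : Type := discAlgebra

instance : NormedCommRing DiscAlgebra := inferInstanceAs (NormedCommRing discAlgebra)

instance : NormedAlgebra ℂ DiscAlgebra := inferInstanceAs (NormedAlgebra ℂ discAlgebra)

instance : CompleteSpace DiscAlgebra := isClosed_discAlgebra.completeSpace_coe

/-- Evaluation at a point of the closed disc. -/
def discEval (w : Disc) : DiscAlgebra →ₐ[ℂ] ℂ :=
  ((ContinuousMap.evalAlgHom ℂ ℂ w).comp discAlgebra.val : discAlgebra →ₐ[ℂ] ℂ)

theorem discAlgebra_ext {f g : DiscAlgebra} (h : ∀ w, discEval w f = discEval w g) : f = g :=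
  Subtype.ext (ContinuousMap.ext h)

/-- The origin of the closed disc. -/
def discZero : Disc := ⟨0, by simp⟩

/-- The coordinate function in the disc algebra. -/
def discZ : DiscAlgebra :=
  ⟨⟨fun w => w.1, continuous_subtype_val⟩, differentiableOn_id.congr fun z hz => by
    simp [extendZero_of_mem _ (ball_subset_disc hz)]⟩

theorem discEval_discZ (w : Disc) : discEval w discZ = w.1 := rfl

theorem continuousOn_extendZero (f : C(Disc, ℂ)) :
    ContinuousOn (extendZero f) (Metric.closedBall 0 1) := by
  rw [continuousOn_iff_continuous_domRestrict]
  exact f.continuous.congr fun w => (extendZero_coe f w).symm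

/-- The quotient (a - a(0))/z has a removable singularity at 0, and `dslope` is its extension. -/
theorem exists_discShift (a : DiscAlgebra) :
    ∃ b : DiscAlgebra, a = discEval discZero a • 1 + discZ * b := by
  have hd : DifferentiableOn ℂ (extendZero a.1) (Metric.ball 0 1) := a.2
  have h1 : ContinuousOn (dslope (extendZero a.1) 0) (Metric.closedBall 0 1) :=
    (continuousOn_dslope (Metric.closedBall_mem_nhds 0 one_pos)).2 ⟨continuousOn_extendZero a.1,
      hd.differentiableAt (Metric.ball_mem_nhds 0 one_pos)⟩
  let b : C(Disc, ℂ) := ⟨fun w => dslope (extendZero a.1) 0 w, h1.domRestrict⟩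
  have hb : DifferentiableOn ℂ (extendZero b) (Metric.ball 0 1) :=
    ((Complex.differentiableOn_dslope (Metric.ball_mem_nhds 0 one_pos)).2 hd).congr fun z hz => by
      rw [extendZero_of_mem _ (ball_subset_disc hz)]
      rfl
  obtain ⟨b', hb'⟩ : ∃ b' : DiscAlgebra, ∀ w : Disc,
      discEval w b' = dslope (extendZero a.1) 0 w.1 :=
    ⟨(⟨b, hb⟩ : discAlgebra), fun _ => rfl⟩
  refine ⟨b', discAlgebra_ext fun w => ?_⟩
  have h2 := sub_smul_dslope (extendZero a.1) 0 w.1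
  rw [extendZero_coe, sub_zero] at h2
  have h3 : extendZero a.1 0 = discEval discZero a := extendZero_coe a.1 discZero
  rw [h3, smul_eq_mul] at h2
  rw [map_add, map_mul, map_smul, map_one, smul_eq_mul, mul_one, discEval_discZ, hb',
    h2, add_sub_cancel]
  rfl

theorem discZ_mul_eq_zero {b : DiscAlgebra} (h : discZ * b = 0) : b = 0 := by
  have h1 : ∀ w : Disc, w.1 ≠ 0 → discEval w b = 0 := fun w hw => by
    have := congrArg (discEval w) h
    rw [map_mul, map_zero, discEval_discZ] at this
    exact (mul_eq_zero.1 this).resolve_left hw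
  refine discAlgebra_ext fun w => ?_
  rw [map_zero]
  by_cases hw : w.1 = 0
  · have hd : DifferentiableOn ℂ (extendZero b.1) (Metric.ball 0 1) := b.2
    have hc := (hd.differentiableAt (Metric.ball_mem_nhds 0 one_pos)).continuousAt.tendsto
    have h2 : (fun _ => (0 : ℂ)) =ᶠ[𝓝[≠] 0] extendZero b.1 := by
      filter_upwards [self_mem_nhdsWithin, mem_nhdsWithin_of_mem_nhds
        (Metric.closedBall_mem_nhds (0 : ℂ) one_pos)] with z hz hz'
      rw [extendZero_of_mem _ hz']
      exact (h1 ⟨z, hz'⟩ hz).symm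
    have h3 := tendsto_nhds_unique (hc.mono_left nhdsWithin_le_nhds)
      (tendsto_const_nhds.congr' h2)
    have h4 : w = discZero := Subtype.ext hw
    rw [h4]
    exact (extendZero_coe b.1 discZero).symm.trans h3
  · exact h1 w hw

/-- Recombination of the value at zero and the backward shift. -/
def discCombine : ℂ × DiscAlgebra →L[ℂ] DiscAlgebra :=
  (ContinuousLinearMap.fst ℂ ℂ DiscAlgebra).smulRight 1 +
    (ContinuousLinearMap.mul ℂ DiscAlgebra discZ).comp (ContinuousLinearMap.snd ℂ ℂ DiscAlgebra)

/-- The splitting of the disc algebra into constants and multiples of the coordinate. -/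
def discEquiv : (ℂ × DiscAlgebra) ≃L[ℂ] DiscAlgebra :=
  -- The open mapping theorem makes the inverse continuous, so the backward shift is a bounded
  -- operator.
  ContinuousLinearEquiv.ofBijective discCombine
    (by
      rw [LinearMap.ker_eq_bot']
      rintro ⟨c, b⟩ h
      replace h : c • 1 + discZ * b = 0 := h
      have h1 := congrArg (discEval discZero) h
      rw [map_add, map_mul, map_smul, map_one, map_zero, discEval_discZ] at h1
      have h2 : c = 0 := by simpa [discZero] using h1
      rw [h2, zero_smul, zero_add] at h
      rw [h2, discZ_mul_eq_zero h]
      rfl)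
    (by
      rw [LinearMap.range_eq_top]
      intro a
      obtain ⟨b, hb⟩ := exists_discShift a
      exact ⟨(discEval discZero a, b), hb.symm⟩)

/-- The backward shift on the disc algebra. -/
def discShift : DiscAlgebra →L[ℂ] DiscAlgebra :=
  (ContinuousLinearMap.snd ℂ ℂ DiscAlgebra).comp (discEquiv.symm : DiscAlgebra →L[ℂ] _)

theorem discShift_combine (c : ℂ) (b : DiscAlgebra) : discShift (c • 1 + discZ * b) = b := by
  have : discEquiv.symm (discEquiv (c, b)) = (c, b) := discEquiv.symm_apply_apply _
  exact congrArg Prod.snd this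

theorem discShift_discZ_mul (b : DiscAlgebra) : discShift (discZ * b) = b := by
  simpa using discShift_combine 0 b

theorem eq_add_discShift (a : DiscAlgebra) :
    a = discEval discZero a • 1 + discZ * discShift a := by
  obtain ⟨b, hb⟩ := exists_discShift a
  have : discShift a = b := by
    rw [hb]
    exact discShift_combine _ b
  rw [this]
  exact hb

theorem discShift_pow_mul (d : ℕ) (b : DiscAlgebra) : (discShift ^ d) (discZ ^ d * b) = b := by
  induction d generalizing b with
  | zero => simp
  | succ d ih =>
    rw [pow_succ, pow_succ', mul_assoc]
    change (discShift ^ d) (discShift (discZ * (discZ ^ d * b))) = b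
    rw [discShift_discZ_mul, ih]

theorem eq_sum_add_discShift_pow (d : ℕ) (a : DiscAlgebra) :
    a = ∑ k ∈ Finset.range d, discEval discZero ((discShift ^ k) a) • discZ ^ k +
      discZ ^ d * (discShift ^ d) a := by
  induction d with
  | zero => simp
  | succ d ih =>
    conv_lhs => rw [ih, eq_add_discShift ((discShift ^ d) a)]
    rw [Finset.sum_range_succ, pow_succ' discShift]
    change _ = _ + _ + _ * discShift ((discShift ^ d) a)
    rw [mul_add, mul_smul_comm, mul_one]
    ring

end DiscAlgebra

end BruceRoberts

end

/-! ### Weierstrass division. -/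

noncomputable section

namespace BruceRoberts

variable {n : ℕ}

/-- A germ of a holomorphic function, regarded as a germ of a holomorphic family of functions of its
`i`-th variable on a small disc. -/
theorem exists_discLift {f : (Fin n → ℂ) → ℂ} (hf : AnalyticAt ℂ f 0) (i : Fin n) :
    ∀ᶠ σ in 𝓝 (0 : ℂ), ∃ G : (Fin n → ℂ) → DiscAlgebra, AnalyticAt ℂ G 0 ∧
      (∀ x t, G (Function.update x i t) = G x) ∧
      ∀ᶠ x in 𝓝 0, ∀ w : Disc, discEval w (G x) = f (Function.update x i (σ * w)) := by
  obtain ⟨F, hF, hχ⟩ := exists_functionalCalculus (A := DiscAlgebra) hf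
  let b : ℂ → (Fin n → ℂ) → Fin n → DiscAlgebra := fun σ x =>
    Function.update (fun j => x j • (1 : DiscAlgebra)) i (σ • discZ)
  have hb0 : Continuous fun σ => b σ 0 := by
    refine continuous_pi fun j => ?_
    by_cases h : j = i
    · subst h
      simp only [b, Function.update_self]
      fun_prop
    · simp only [b, Function.update_of_ne h]
      fun_prop
  have hb00 : b 0 0 = 0 := by
    ext1 j
    by_cases h : j = i
    · subst h; simp [b]
    · simp [b, h]
  have ht : Tendsto (fun σ => b σ 0) (𝓝 0) (𝓝 0) := by
    have := hb0.tendsto 0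
    rwa [hb00] at this
  filter_upwards [ht.eventually hF.eventually_analyticAt,
    ht.eventually hχ.eventually_nhds] with σ h1 h2
  have hba : AnalyticAt ℂ (b σ) 0 := by
    refine AnalyticAt.pi fun j => ?_
    by_cases h : j = i
    · subst h
      simp only [Function.update_self]
      exact analyticAt_const
    · simp only [Function.update_of_ne h]
      exact ((ContinuousLinearMap.proj (R := ℂ) (φ := fun _ : Fin n => ℂ) j).analyticAt 0).smul
        analyticAt_const
  refine ⟨fun x => F (b σ x), h1.comp hba, fun x t => ?_, ?_⟩
  · have : b σ (Function.update x i t) = b σ x := by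
      ext1 j
      by_cases h : j = i
      · subst h; simp [b]
      · simp [b, h]
    simp only [this]
  · filter_upwards [hba.continuousAt.eventually h2] with x hx w
    rw [hx (discEval w)]
    congr 1
    ext j
    by_cases h : j = i
    · subst h
      simp [b, discEval_discZ]
    · simp [b, h]

theorem AnalyticAt.clm_apply {E F G : Type} [NormedAddCommGroup E] [NormedSpace ℂ E]
    [NormedAddCommGroup F] [NormedSpace ℂ F] [NormedAddCommGroup G] [NormedSpace ℂ G]
    {T : E → F →L[ℂ] G} {v : E → F} {x : E} (hT : AnalyticAt ℂ T x) (hv : AnalyticAt ℂ v x) :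
    AnalyticAt ℂ (fun y => T y (v y)) x :=
  ((ContinuousLinearMap.id ℂ (F →L[ℂ] G)).analyticAt_bilinear (T x, v x)).comp₂ hT hv

/-- With S the backward shift and c = (1 - wS)⁻¹b, one has b = c - wSc, while c = c(0) + zSc; at z =
w this gives b(w) = c(0). Evaluation at w thereby becomes analytic in w as well as in b. -/
theorem discEval_eq_inverse (w : Disc)
    (hw : IsUnit (1 - w.1 • discShift : DiscAlgebra →L[ℂ] DiscAlgebra)) (b : DiscAlgebra) :
    discEval w b = discEval discZero (Ring.inverse (1 - w.1 • discShift) b) := by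
  set c := Ring.inverse (1 - w.1 • discShift) b
  have h1 : b = c - w.1 • discShift c := by
    have := congrArg (fun T : DiscAlgebra →L[ℂ] DiscAlgebra => T b) (Ring.mul_inverse_cancel _ hw)
    exact this.symm
  have h2 := congrArg (discEval w) (eq_add_discShift c)
  rw [map_add, map_mul, map_smul, map_one, discEval_discZ, smul_eq_mul, mul_one] at h2
  rw [h1, map_sub, h2, map_smul, smul_eq_mul, add_sub_cancel_right]

/-- Linear algebra behind Weierstrass division. -/
def divOp (d : ℕ) (c : DiscAlgebra) : DiscAlgebra →L[ℂ] DiscAlgebra :=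
  1 + (ContinuousLinearMap.mul ℂ DiscAlgebra (c - discZ ^ d)).comp (discShift ^ d)

theorem divOp_apply (d : ℕ) (c a : DiscAlgebra) :
    divOp d c a = a + (c - discZ ^ d) * (discShift ^ d) a := rfl

/-- With S the backward shift, S^d applied to a + z^d(e - 1)S^d a is e S^d a, so the operators
attached to z^d c and z^d e are mutually inverse when ce = 1. -/
theorem divOp_mul (d : ℕ) (c e : DiscAlgebra) (h : c * e = 1) :
    divOp d (discZ ^ d * c) * divOp d (discZ ^ d * e) = 1 := by
  ext1 a
  change divOp d _ (divOp d _ a) = a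
  simp only [divOp_apply]
  have h1 : discZ ^ d * e - discZ ^ d = discZ ^ d * (e - 1) := by ring
  rw [h1, mul_assoc, map_add, discShift_pow_mul]
  linear_combination (discZ ^ d * (discShift ^ d) a) * h

theorem isUnit_divOp (d : ℕ) {c : DiscAlgebra} (h : IsUnit c) : IsUnit (divOp d (discZ ^ d * c)) := by
  obtain ⟨e, he⟩ := h.exists_right_inv
  exact ⟨⟨_, _, divOp_mul d c e he, divOp_mul d e c (by rw [mul_comm, he])⟩, rfl⟩

/-- Weierstrass division with respect to the `i`-th variable. -/
theorem weierstrass_division {f g : (Fin n → ℂ) → ℂ} (hf : AnalyticAt ℂ f 0)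
    (hg : AnalyticAt ℂ g 0) (i : Fin n) (d : ℕ) {u : ℂ → ℂ} (hu : AnalyticAt ℂ u 0) (hu0 : u 0 ≠ 0)
    (hfu : ∀ᶠ t in 𝓝 (0 : ℂ), f (Pi.single i t) = t ^ d * u t) :
    ∃ (q : (Fin n → ℂ) → ℂ) (r : ℕ → (Fin n → ℂ) → ℂ), AnalyticAt ℂ q 0 ∧
      (∀ k, AnalyticAt ℂ (r k) 0) ∧ (∀ k x t, r k (Function.update x i t) = r k x) ∧
      ∀ᶠ x in 𝓝 0, g x = q x * f x + ∑ k ∈ Finset.range d, r k x * x i ^ k := by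
  have hpi : AnalyticAt ℂ (fun x : Fin n → ℂ => x i) 0 :=
    (ContinuousLinearMap.proj (R := ℂ) (φ := fun _ : Fin n => ℂ) i).analyticAt 0
  have hu1 : AnalyticAt ℂ (fun x : Fin n → ℂ => u (x i)) 0 := hu.comp_of_eq hpi rfl
  have hu2 : AnalyticAt ℂ (fun x : Fin n → ℂ => (u (x i))⁻¹) 0 := hu1.inv hu0
  have hball : ∀ {P : ℂ → Prop}, (∀ᶠ t in 𝓝 (0 : ℂ), P t) →
      ∀ᶠ σ in 𝓝 (0 : ℂ), ∀ w : Disc, P (σ * w) := by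
    intro P hP
    obtain ⟨ε, hε, h⟩ := Metric.eventually_nhds_iff.1 hP
    filter_upwards [Metric.ball_mem_nhds (0 : ℂ) hε] with σ hσ w
    apply h
    rw [mem_ball_zero_iff] at hσ
    rw [dist_zero_right, norm_mul]
    have hw : ‖(w : ℂ)‖ ≤ 1 := mem_closedBall_zero_iff.1 w.2
    exact (mul_le_of_le_one_right (norm_nonneg _) hw).trans_lt hσ
  have hev := (exists_discLift hf i).and ((exists_discLift hg i).and ((exists_discLift hu1 i).and
    ((exists_discLift hu2 i).and ((hball hfu).and (hball
      (hu.continuousAt.eventually_ne hu0))))))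
  -- All conditions hold for small σ, and the punctured neighbourhood provides a nonzero one; σ is
  -- the scale of the disc for the i-th variable.
  obtain ⟨σ, ⟨⟨G, hGa, hGu, hG⟩, ⟨H, hHa, hHu, hH⟩, ⟨U, -, -, hU⟩, ⟨V, -, -, hV⟩, h5, h6⟩, hσ⟩ :=
    ((hev.filter_mono nhdsWithin_le_nhds).and (self_mem_nhdsWithin (s := {(0 : ℂ)}ᶜ))).exists
  replace hσ : σ ≠ 0 := hσ
  have hUV : U 0 * V 0 = 1 := by
    refine discAlgebra_ext fun w => ?_
    rw [map_mul, map_one, hU.self_of_nhds, hV.self_of_nhds]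
    simp only [Function.update_self]
    exact mul_inv_cancel₀ (h6 w)
  -- At x = 0 the family is z^d times a unit, exactly the case in which the division operator is
  -- invertible; invertibility then persists nearby.
  have hG0 : G 0 = discZ ^ d * (σ ^ d • U 0) := by
    refine discAlgebra_ext fun w => ?_
    rw [map_mul, map_smul, map_pow, hU.self_of_nhds, hG.self_of_nhds, discEval_discZ]
    simp only [Function.update_self]
    have h7 := h5 w
    rw [mul_pow] at h7
    change f (Pi.single i (σ * w)) = _
    rw [h7, smul_eq_mul]
    ring
  have hunit : IsUnit (divOp d (G 0)) := by
    rw [hG0]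
    refine isUnit_divOp d (IsUnit.of_mul_eq_one ((σ ^ d)⁻¹ • V 0) ?_)
    rw [smul_mul_smul_comm, hUV, mul_inv_cancel₀ (pow_ne_zero d hσ), one_smul]
  let L : (Fin n → ℂ) → DiscAlgebra →L[ℂ] DiscAlgebra := fun x => divOp d (G x)
  have hLa : AnalyticAt ℂ L 0 := by
    have h8 : AnalyticAt ℂ (fun x => G x - discZ ^ d) 0 := hGa.sub analyticAt_const
    have h9 := (ContinuousLinearMap.analyticAt
      (((ContinuousLinearMap.compL ℂ DiscAlgebra DiscAlgebra DiscAlgebra).flip (discShift ^ d)).comp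
        (ContinuousLinearMap.mul ℂ DiscAlgebra)) (G 0 - discZ ^ d)).comp_of_eq h8 rfl
    exact (analyticAt_const (v := (1 : DiscAlgebra →L[ℂ] DiscAlgebra))).add h9
  have hinv : AnalyticAt ℂ (fun x => Ring.inverse (L x)) 0 := by
    have := analyticAt_inverse (𝕜 := ℂ) hunit.unit
    exact this.comp_of_eq hLa hunit.unit_spec.symm
  let a : (Fin n → ℂ) → DiscAlgebra := fun x => Ring.inverse (L x) (H x)
  have haa : AnalyticAt ℂ a 0 := AnalyticAt.clm_apply hinv hHa
  have hau : ∀ x t, a (Function.update x i t) = a x := fun x t => by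
    simp only [a, L, hGu, hHu]
  have hLunit : ∀ᶠ x in 𝓝 0, IsUnit (L x) :=
    hLa.continuousAt.eventually (Units.isOpen.mem_nhds hunit)
  -- Splitting a into its first d Taylor terms and z^d S^d a, for S the backward shift, turns L a =
  -- H into division of H by G with quotient S^d a.
  have heq : ∀ᶠ x in 𝓝 0, H x = (discShift ^ d) (a x) * G x +
      ∑ k ∈ Finset.range d, discEval discZero ((discShift ^ k) (a x)) • discZ ^ k := by
    filter_upwards [hLunit] with x hx
    have h10 : L x (a x) = H x :=
      congrArg (fun T : DiscAlgebra →L[ℂ] DiscAlgebra => T (H x)) (Ring.mul_inverse_cancel _ hx)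
    rw [← h10]
    simp only [L, divOp_apply]
    have h11 := eq_sum_add_discShift_pow d (a x)
    linear_combination h11
  let ev0 : DiscAlgebra →L[ℂ] ℂ := AlgHom.toContinuousLinearMap (discEval discZero)
  -- The quotient must be evaluated at the moving point w = σ⁻¹xᵢ, and the resolvent makes that
  -- value analytic in x.
  let K : (Fin n → ℂ) → DiscAlgebra →L[ℂ] DiscAlgebra := fun x => 1 - (σ⁻¹ * x i) • discShift
  have hKa : AnalyticAt ℂ K 0 :=
    analyticAt_const.sub ((analyticAt_const.mul hpi).smul analyticAt_const)
  have hK0 : K 0 = 1 := by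
    have h0 : (0 : ℂ) • discShift = 0 := zero_smul ℂ discShift
    simp only [K, Pi.zero_apply, mul_zero, h0, sub_zero]
  have hKinv : AnalyticAt ℂ (fun x => Ring.inverse (K x)) 0 :=
    (analyticAt_inverse (𝕜 := ℂ) (1 : (DiscAlgebra →L[ℂ] DiscAlgebra)ˣ)).comp_of_eq hKa hK0
  have hKunit : ∀ᶠ x in 𝓝 0, IsUnit (K x) :=
    hKa.continuousAt.eventually (Units.isOpen.mem_nhds (by rw [hK0]; exact isUnit_one))
  refine ⟨fun x => ev0 (Ring.inverse (K x) ((discShift ^ d) (a x))),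
    fun k x => (σ ^ k)⁻¹ * ev0 ((discShift ^ k) (a x)), ?_, fun k => ?_, fun k x t => ?_, ?_⟩
  · exact (ev0.analyticAt _).comp (AnalyticAt.clm_apply hKinv (((discShift ^ d).analyticAt _).comp haa))
  · exact analyticAt_const.mul ((ev0.analyticAt _).comp (((discShift ^ k).analyticAt _).comp haa))
  · simp only [hau]
  · have hsmall : ∀ᶠ x : Fin n → ℂ in 𝓝 0, σ⁻¹ * x i ∈ Metric.closedBall (0 : ℂ) 1 := by
      have : Tendsto (fun x : Fin n → ℂ => σ⁻¹ * x i) (𝓝 0) (𝓝 0) := by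
        have h0 : Continuous fun x : Fin n → ℂ => σ⁻¹ * x i := by fun_prop
        simpa using h0.tendsto 0
      exact this.eventually (Metric.closedBall_mem_nhds (0 : ℂ) one_pos)
    filter_upwards [hsmall, hKunit, heq, hG, hH] with x h1 h2 h3 h4 h5
    let w : Disc := ⟨σ⁻¹ * x i, h1⟩
    have hw : Function.update x i (σ * w) = x := by
      change Function.update x i (σ * (σ⁻¹ * x i)) = x
      rw [mul_inv_cancel_left₀ hσ, Function.update_eq_self]
    have h6 := congrArg (discEval w) h3
    rw [h5 w, hw, map_add, map_mul, h4 w, hw, map_sum, discEval_eq_inverse w h2] at h6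
    rw [h6]
    congr 1
    refine Finset.sum_congr rfl fun k _ => ?_
    rw [map_smul, map_pow, discEval_discZ, smul_eq_mul]
    change _ * (σ⁻¹ * x i) ^ k = (σ ^ k)⁻¹ * discEval discZero ((discShift ^ k) (a x)) * x i ^ k
    rw [mul_pow, inv_pow]
    ring

end BruceRoberts

end

/-! ### The local ring of germs and the regularity of its coordinates. -/

noncomputable section

namespace BruceRoberts

/-- The ring of functions on `ℂⁿ` that are holomorphic near `0`. -/
def anFun (n : ℕ) : Subring ((Fin n → ℂ) → ℂ) where
  carrier := {f | AnalyticAt ℂ f 0}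
  mul_mem' hf hg := hf.mul hg
  one_mem' := analyticAt_const
  add_mem' hf hg := hf.add hg
  zero_mem' := analyticAt_const
  neg_mem' hf := hf.neg

/-- The germ at `0` of a function holomorphic near `0`. -/
def germ (n : ℕ) : anFun n →+* O n where
  toFun f := ⟨(f.1 : Germ (𝓝 (0 : Fin n → ℂ)) ℂ), f.1, f.2, rfl⟩
  map_one' := rfl
  map_mul' _ _ := rfl
  map_zero' := rfl
  map_add' _ _ := rfl

variable {n m : ℕ}

theorem germ_surjective : Function.Surjective (germ n) := by
  rintro ⟨_, f, hf, rfl⟩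
  exact ⟨⟨f, hf⟩, rfl⟩

theorem germ_eq_iff {f g : anFun n} : germ n f = germ n g ↔ f.1 =ᶠ[𝓝 0] g.1 := by
  constructor
  · intro h
    exact Quotient.exact' (congrArg Subtype.val h)
  · intro h
    exact Subtype.ext (Quotient.sound' h)

/-- Evaluation at a point of a function holomorphic near `0`. -/
def evalAt (x : Fin n → ℂ) : anFun n →+* ℂ := (Pi.evalRingHom _ x).comp (anFun n).subtype

@[simp]
theorem evalAt_apply (x : Fin n → ℂ) (f : anFun n) : evalAt x f = f.1 x := rfl

/-- The value at `0` of a germ. -/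
def O.value : O n →+* ℂ :=
  (Germ.valueRingHom : Germ (𝓝 (0 : Fin n → ℂ)) ℂ →+* ℂ).comp (holGerms n).val.toRingHom

@[simp]
theorem value_germ (f : anFun n) : O.value (germ n f) = f.1 0 := rfl

theorem isUnit_of_value_ne_zero {f : O n} (h : O.value f ≠ 0) : IsUnit f := by
  obtain ⟨f, rfl⟩ := germ_surjective f
  rw [value_germ] at h
  refine IsUnit.of_mul_eq_one (germ n ⟨fun x => (f.1 x)⁻¹, f.2.inv h⟩) ?_
  rw [← map_mul, ← map_one (germ n), germ_eq_iff]
  filter_upwards [f.2.continuousAt.eventually_ne h] with x hx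
  exact mul_inv_cancel₀ hx

/-- Composition with a holomorphic map germ. -/
def pullFun (h : (Fin m → ℂ) → Fin n → ℂ) (hh : AnalyticAt ℂ h 0) (h0 : h 0 = 0) :
    anFun n →+* anFun m where
  toFun f := ⟨f.1 ∘ h, f.2.comp_of_eq hh h0⟩
  map_one' := rfl
  map_mul' _ _ := rfl
  map_zero' := rfl
  map_add' _ _ := rfl

/-- Composition with a holomorphic map germ. -/
def pull (h : (Fin m → ℂ) → Fin n → ℂ) (hh : AnalyticAt ℂ h 0) (h0 : h 0 = 0) : O n →+* O m :=
  have ht : Tendsto h (𝓝 0) (𝓝 0) := by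
    have := hh.continuousAt.tendsto
    rwa [h0] at this
  { toFun := fun f => ⟨f.1.compTendsto h ht, by
      obtain ⟨_, f, hf, rfl⟩ := f
      exact ⟨f ∘ h, hf.comp_of_eq hh h0, rfl⟩⟩
    map_one' := rfl
    map_mul' := by
      rintro ⟨_, f, hf, rfl⟩ ⟨_, g, hg, rfl⟩
      rfl
    map_zero' := rfl
    map_add' := by
      rintro ⟨_, f, hf, rfl⟩ ⟨_, g, hg, rfl⟩
      rfl }

theorem pull_germ (h : (Fin m → ℂ) → Fin n → ℂ) (hh : AnalyticAt ℂ h 0) (h0 : h 0 = 0)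
    (f : anFun n) : pull h hh h0 (germ n f) = germ m (pullFun h hh h0 f) := rfl

theorem analyticAt_coord (i : Fin n) : AnalyticAt ℂ (fun x : Fin n → ℂ => x i) 0 :=
  (ContinuousLinearMap.proj (R := ℂ) (φ := fun _ : Fin n => ℂ) i).analyticAt 0

/-- The coordinate functions. -/
def coordFun (i : Fin n) : anFun n := ⟨fun x => x i, analyticAt_coord i⟩

/-- The germs of the coordinate functions. -/
def coord (i : Fin n) : O n := germ n (coordFun i)

/-- Off the hyperplane xᵢ = 0 the factor cancels; on it f vanishes by continuity along the i-th
axis. -/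
theorem coord_mul_eq_zero {i : Fin n} {f : O n} (h : coord i * f = 0) : f = 0 := by
  obtain ⟨f, rfl⟩ := germ_surjective f
  rw [coord, ← map_mul, ← map_zero (germ n), germ_eq_iff] at h
  rw [← map_zero (germ n), germ_eq_iff]
  filter_upwards [h.eventually_nhds, f.2.eventually_analyticAt] with x hx hf
  by_cases hxi : x i = 0
  · have h1 : Continuous fun t : ℂ => Function.update x i t := by fun_prop
    have h2 : Tendsto (fun t : ℂ => Function.update x i t) (𝓝 0) (𝓝 x) := by
      have := h1.tendsto 0
      rwa [← hxi, Function.update_eq_self, hxi] at this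
    have h3 : Tendsto (fun t : ℂ => f.1 (Function.update x i t)) (𝓝[≠] 0) (𝓝 (f.1 x)) :=
      (hf.continuousAt.tendsto.comp h2).mono_left nhdsWithin_le_nhds
    refine tendsto_nhds_unique h3 (tendsto_const_nhds.congr' ?_)
    filter_upwards [(h2.eventually hx).filter_mono nhdsWithin_le_nhds, self_mem_nhdsWithin]
      with t ht ht0
    have h4 : Function.update x i t i * f.1 (Function.update x i t) = 0 := ht
    rw [Function.update_self] at h4
    exact ((mul_eq_zero.1 h4).resolve_left ht0).symm
  · exact (mul_eq_zero.1 (hx.self_of_nhds : x i * f.1 x = 0)).resolve_left hxi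

/-- The projection setting the first `k` coordinates to zero. -/
def killCoords (k : ℕ) (x : Fin n → ℂ) : Fin n → ℂ := fun j => if (j : ℕ) < k then 0 else x j

theorem analyticAt_killCoords (k : ℕ) : AnalyticAt ℂ (killCoords (n := n) k) 0 := by
  refine AnalyticAt.pi fun j => ?_
  by_cases h : (j : ℕ) < k
  · simp only [killCoords, h, if_true]
    exact analyticAt_const
  · simp only [killCoords, h, if_false]
    exact analyticAt_coord j

theorem killCoords_zero (k : ℕ) : killCoords k (0 : Fin n → ℂ) = 0 := by
  ext j
  simp [killCoords]

theorem analyticAt_update_zero (i : Fin n) :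
    AnalyticAt ℂ (fun x : Fin n → ℂ => Function.update x i 0) 0 := by
  refine AnalyticAt.pi fun j => ?_
  by_cases h : j = i
  · subst h
    simp only [Function.update_self]
    exact analyticAt_const
  · simp only [Function.update_of_ne h]
    exact analyticAt_coord j

/-- Hadamard's lemma in the `i`-th variable. -/
theorem exists_eq_coord_mul_add (i : Fin n) (f : anFun n) : ∃ v : O n,
    germ n f = coord i * v +
      germ n (pullFun (fun x => Function.update x i 0) (analyticAt_update_zero i) (by simp) f) := by
  -- Dividing by xᵢ itself, with d = 1, leaves a remainder independent of xᵢ, hence equal to the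
  -- restriction of f to xᵢ = 0.
  obtain ⟨q, r, hq, -, hru, h⟩ := weierstrass_division (analyticAt_coord i) f.2 i 1
    (u := fun _ => 1) analyticAt_const one_ne_zero (Eventually.of_forall fun t => by simp)
  refine ⟨germ n ⟨q, hq⟩, ?_⟩
  rw [coord, ← map_mul, ← map_add, germ_eq_iff]
  have ht : Tendsto (fun x : Fin n → ℂ => Function.update x i 0) (𝓝 0) (𝓝 0) := by
    have := (analyticAt_update_zero i).continuousAt.tendsto
    rwa [show Function.update (0 : Fin n → ℂ) i 0 = 0 by simp] at this
  filter_upwards [h, ht.eventually h] with x h1 h2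
  change f.1 x = x i * q x + f.1 (Function.update x i 0)
  rw [h1, h2]
  simp [hru]
  ring

/-- The coordinates, as a sequence of germs. -/
def coordSeq (n : ℕ) (j : ℕ) : O n := if h : j < n then coord ⟨j, h⟩ else 0

theorem exists_eq_sum_add_killCoords (f : anFun n) (k : ℕ) (hk : k ≤ n) : ∃ v : ℕ → O n,
    germ n f = ∑ j ∈ Finset.range k, coordSeq n j * v j +
      pull (killCoords k) (analyticAt_killCoords k) (killCoords_zero k) (germ n f) := by
  induction k with
  | zero =>
    refine ⟨0, ?_⟩
    rw [pull_germ, Finset.sum_range_zero, zero_add, germ_eq_iff]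
    refine Eventually.of_forall fun x => ?_
    change f.1 x = f.1 (killCoords 0 x)
    congr 1
  | succ k ih =>
    obtain ⟨v, hv⟩ := ih (by omega)
    obtain ⟨w, hw⟩ := exists_eq_coord_mul_add ⟨k, by omega⟩
      (pullFun (killCoords k) (analyticAt_killCoords k) (killCoords_zero k) f)
    refine ⟨fun j => if j = k then w else v j, ?_⟩
    conv_lhs => rw [hv, pull_germ, hw]
    rw [Finset.sum_range_succ, add_assoc]
    congr 1
    · refine Finset.sum_congr rfl fun j hj => ?_
      simp only [if_neg (Finset.mem_range.1 hj).ne]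
    · simp only [if_true]
      rw [coordSeq, dif_pos (by omega)]
      congr 1
      rw [pull_germ, germ_eq_iff]
      refine Eventually.of_forall fun x => ?_
      change f.1 (killCoords k (Function.update x ⟨k, by omega⟩ 0)) = f.1 (killCoords (k + 1) x)
      refine congrArg f.1 (funext fun j => ?_)
      by_cases h : j = ⟨k, by omega⟩
      · subst h; simp [killCoords]
      · have h' : (j : ℕ) ≠ k := fun h'' => h (Fin.ext h'')
        have : (j : ℕ) < k + 1 ↔ (j : ℕ) < k := by omega
        simp [killCoords, h, this]

/-- The coordinates form a regular sequence on the local ring of `ℂⁿ`. -/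
theorem weaklyRegular_coordSeq : WeaklyRegular (coordSeq n) n (O n) := by
  intro i hi f u hu
  simp only [smul_eq_mul] at hu ⊢
  -- Setting the first i coordinates to zero reduces the relation to xᵢ · f| = 0, so f| = 0;
  -- iterated Hadamard then expresses f through those coordinates.
  have h1 : pull (killCoords i) (analyticAt_killCoords i) (killCoords_zero i) f = 0 := by
    have h2 := congrArg (pull (killCoords i) (analyticAt_killCoords i) (killCoords_zero i)) hu
    rw [map_mul, map_sum, Finset.sum_eq_zero] at h2
    · refine coord_mul_eq_zero (i := ⟨i, hi⟩) ?_
      rw [← h2]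
      congr 1
      rw [coordSeq, dif_pos hi, coord, pull_germ, germ_eq_iff]
      refine Eventually.of_forall fun x => ?_
      change x ⟨i, hi⟩ = killCoords i x ⟨i, hi⟩
      simp [killCoords]
    · intro j hj
      rw [Finset.mem_range] at hj
      have h3 : pull (killCoords i) (analyticAt_killCoords i) (killCoords_zero i)
          (coordSeq n j) = 0 := by
        rw [coordSeq, dif_pos (hj.trans hi), coord, pull_germ, ← map_zero (germ n), germ_eq_iff]
        refine Eventually.of_forall fun x => ?_
        change killCoords i x ⟨j, hj.trans hi⟩ = 0
        simp [killCoords, hj]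
      rw [map_mul, h3, zero_mul]
  obtain ⟨f, rfl⟩ := germ_surjective f
  obtain ⟨v, hv⟩ := exists_eq_sum_add_killCoords f i hi.le
  rw [h1, add_zero] at hv
  exact ⟨v, hv⟩

end BruceRoberts

end

/-! ### Common roots, root bounds and polynomials over the tail variables. -/

noncomputable section

namespace BruceRoberts

-- Each vanishing resultant gives a root ρ of W with ∑ⱼ l^j Rⱼ(ρ) = 0. There are at most d distinct
-- roots and ds + 1 values of l, so one root serves more than s values. The polynomial ∑ⱼ Rⱼ(ρ)X^j,
-- of degree below s, then has too many zeros and is zero.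
open Polynomial in
theorem exists_common_root {d s : ℕ} {W : ℂ[X]} (hW : W.Monic) (hd : W.natDegree = d)
    {R : Fin s → ℂ[X]} (hR : ∀ j, (R j).natDegree ≤ d)
    (h : ∀ l ∈ Finset.range (d * s + 1), resultant W (∑ j : Fin s, C ((l : ℂ) ^ (j : ℕ)) * R j) d d = 0) :
    ∃ ρ, W.eval ρ = 0 ∧ ∀ j, (R j).eval ρ = 0 := by
  classical
  have h1 : ∀ l ∈ Finset.range (d * s + 1), ∃ ρ ∈ W.roots.toFinset,
      ∑ j : Fin s, (l : ℂ) ^ (j : ℕ) * (R j).eval ρ = 0 := by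
    intro l hl
    have h2 : (∑ j : Fin s, C ((l : ℂ) ^ (j : ℕ)) * R j).natDegree ≤ d :=
      natDegree_sum_le_of_forall_le _ _ fun j _ => (natDegree_C_mul_le _ _).trans (hR j)
    have h3 := resultant_eq_prod_eval W _ d h2 (IsAlgClosed.splits W)
    rw [hd, h l hl, hW.leadingCoeff, one_pow, one_mul, eq_comm, Multiset.prod_eq_zero_iff,
      Multiset.mem_map] at h3
    obtain ⟨ρ, hρ, h4⟩ := h3
    refine ⟨ρ, Multiset.mem_toFinset.2 hρ, ?_⟩
    simpa [eval_finsetSum] using h4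
  choose! ρ hρ hρ' using h1
  have hcard : W.roots.toFinset.card * s < (Finset.range (d * s + 1)).card := by
    rw [Finset.card_range, Nat.lt_succ_iff]
    refine Nat.mul_le_mul_right _ ((Multiset.toFinset_card_le _).trans ?_)
    exact hd ▸ W.card_roots'
  obtain ⟨z, hz, hz'⟩ := Finset.exists_lt_card_fiber_of_mul_lt_card_of_maps_to hρ hcard
  refine ⟨z, (mem_roots'.1 (Multiset.mem_toFinset.1 hz)).2, ?_⟩
  let Q : ℂ[X] := ∑ j : Fin s, C ((R j).eval z) * X ^ (j : ℕ)
  have hQ : Q = 0 := by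
    rcases Nat.eq_zero_or_pos s with rfl | hs
    · simp [Q]
    refine eq_zero_of_natDegree_lt_card_of_eval_eq_zero' Q
      (((Finset.range (d * s + 1)).filter fun l => ρ l = z).image (Nat.cast : ℕ → ℂ)) ?_ ?_
    · intro t ht
      rw [Finset.mem_image] at ht
      obtain ⟨l, hl, rfl⟩ := ht
      rw [Finset.mem_filter] at hl
      have := hρ' l hl.1
      rw [hl.2] at this
      simp only [Q, eval_finsetSum, eval_mul, eval_C, eval_pow, eval_X]
      rw [← this]
      exact Finset.sum_congr rfl fun j _ => mul_comm _ _
    · rw [Finset.card_image_of_injective _ Nat.cast_injective]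
      refine lt_of_le_of_lt (b := s - 1) (natDegree_sum_le_of_forall_le _ _ fun j _ => ?_)
        (lt_of_le_of_lt (Nat.sub_le _ _) hz')
      exact (natDegree_C_mul_X_pow_le _ _).trans (by omega)
  intro j
  have h5 := congrArg (fun p => p.coeff (j : ℕ)) hQ
  simpa [Q, finsetSum_coeff, coeff_C_mul, coeff_X_pow, Fin.val_inj, Finset.sum_ite_eq] using h5

theorem norm_lt_of_root {d : ℕ} {a : ℕ → ℂ} {ε : ℝ} (hε : 0 < ε) (hε1 : ε ≤ 1)
    (ha : ∑ k ∈ Finset.range d, ‖a k‖ < ε ^ d) {z : ℂ}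
    (hz : z ^ d + ∑ k ∈ Finset.range d, a k * z ^ k = 0) : ‖z‖ < ε := by
  by_contra! h
  have h1 : ‖z‖ ^ d ≤ ∑ k ∈ Finset.range d, ‖a k‖ * ‖z‖ ^ k := by
    rw [← norm_pow, eq_neg_of_add_eq_zero_left hz, norm_neg]
    refine (norm_sum_le _ _).trans (le_of_eq (Finset.sum_congr rfl fun k _ => ?_))
    rw [norm_mul, norm_pow]
  rcases le_total ‖z‖ 1 with h2 | h2
  · have h3 : ∑ k ∈ Finset.range d, ‖a k‖ * ‖z‖ ^ k ≤ ∑ k ∈ Finset.range d, ‖a k‖ :=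
      Finset.sum_le_sum fun k _ =>
        mul_le_of_le_one_right (norm_nonneg _) (pow_le_one₀ (norm_nonneg _) h2)
    have h4 : ε ^ d ≤ ‖z‖ ^ d := by gcongr
    linarith
  · have h3 : ∑ k ∈ Finset.range d, ‖a k‖ * ‖z‖ ^ k ≤ (∑ k ∈ Finset.range d, ‖a k‖) * ‖z‖ ^ d := by
      rw [Finset.sum_mul]
      refine Finset.sum_le_sum fun k hk => ?_
      gcongr
      · exact (Finset.mem_range.1 hk).le
    have h4 : ε ^ d ≤ 1 := pow_le_one₀ hε.le hε1
    have h5 : (0 : ℝ) < ‖z‖ ^ d := by positivity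
    nlinarith

theorem eq_zero_of_pow_mul_eq_sum (d : ℕ) {h : ℂ → ℂ} (hh : ContinuousAt h 0) : ∀ {c : ℕ → ℂ},
    (∀ᶠ t in 𝓝[≠] (0 : ℂ), t ^ d * h t = ∑ k ∈ Finset.range d, c k * t ^ k) →
    ∀ k < d, c k = 0 := by
  induction d with
  | zero => simp
  | succ d ih =>
    intro c H
    have h1 : Tendsto (fun t : ℂ => t ^ (d + 1) * h t) (𝓝[≠] 0) (𝓝 0) := by
      have : ContinuousAt (fun t : ℂ => t ^ (d + 1) * h t) 0 := by fun_prop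
      simpa using this.tendsto.mono_left nhdsWithin_le_nhds
    have h2 : Tendsto (fun t : ℂ => ∑ k ∈ Finset.range (d + 1), c k * t ^ k) (𝓝[≠] 0)
        (𝓝 (c 0)) := by
      have : Continuous fun t : ℂ => ∑ k ∈ Finset.range (d + 1), c k * t ^ k := by fun_prop
      have h3 := (this.tendsto 0).mono_left (nhdsWithin_le_nhds (s := {(0 : ℂ)}ᶜ))
      simpa [Finset.sum_range_succ'] using h3
    have h0 : c 0 = 0 := tendsto_nhds_unique (h2.congr' (H.mono fun t ht => ht.symm)) h1
    have h4 := ih (c := fun k => c (k + 1)) (by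
      filter_upwards [H, self_mem_nhdsWithin] with t ht ht0
      rw [Finset.sum_range_succ', h0, zero_mul, add_zero] at ht
      have ht0' : t ≠ 0 := ht0
      apply mul_left_cancel₀ ht0'
      rw [Finset.mul_sum, ← mul_assoc, ← pow_succ', ht]
      refine Finset.sum_congr rfl fun k _ => ?_
      ring)
    rintro (_ | k) hk
    · exact h0
    · exact h4 k (by omega)

variable {n : ℕ}

theorem analyticAt_tail : AnalyticAt ℂ (Fin.tail : (Fin (n + 1) → ℂ) → Fin n → ℂ) 0 :=
  AnalyticAt.pi fun j => analyticAt_coord j.succ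

theorem analyticAt_consZero :
    AnalyticAt ℂ (fun x : Fin n → ℂ => (Fin.cons 0 x : Fin (n + 1) → ℂ)) 0 :=
  AnalyticAt.pi fun j => by
    refine Fin.cases ?_ (fun j => ?_) j
    · exact analyticAt_const
    · exact analyticAt_coord j

theorem tail_zero : Fin.tail (0 : Fin (n + 1) → ℂ) = 0 := rfl

/-- Functions of the last `n` variables as functions of `n + 1` variables. -/
def tailFun : anFun n →+* anFun (n + 1) := pullFun Fin.tail analyticAt_tail tail_zero

/-- Germs in the last `n` variables as germs in `n + 1` variables. -/
def tailPull : O n →+* O (n + 1) := pull Fin.tail analyticAt_tail tail_zero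

theorem tailPull_germ (f : anFun n) : tailPull (germ n f) = germ (n + 1) (tailFun f) := rfl

open Polynomial in
/-- A polynomial with holomorphic coefficients as a holomorphic function. -/
def polyFun : (anFun n)[X] →+* anFun (n + 1) :=
  eval₂RingHom tailFun (coordFun 0)

open Polynomial in
theorem polyFun_apply (P : (anFun n)[X]) (x : Fin (n + 1) → ℂ) :
    (polyFun P).1 x = (P.map (evalAt (Fin.tail x))).eval (x 0) := by
  change evalAt x (eval₂ _ _ P) = _
  rw [hom_eval₂, eval_map]
  rfl

open Polynomial in
/-- The polynomial with coefficients `r 0, …, r (d - 1)`. -/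
def lowPoly {R : Type} [CommRing R] (d : ℕ) (r : ℕ → R) : R[X] :=
  ∑ k ∈ Finset.range d, C (r k) * X ^ k

open Polynomial in
theorem lowPoly_degree_lt {R : Type} [CommRing R] (d : ℕ) (r : ℕ → R) :
    (lowPoly d r).degree < d := by
  rw [← mem_degreeLT]
  refine Submodule.sum_mem _ fun k hk => mem_degreeLT.2 ?_
  exact (degree_C_mul_X_pow_le _ _).trans_lt (by exact_mod_cast Finset.mem_range.1 hk)

open Polynomial in
theorem lowPoly_map {R S : Type} [CommRing R] [CommRing S] (d : ℕ) (r : ℕ → R) (φ : R →+* S) :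
    (lowPoly d r).map φ = lowPoly d fun k => φ (r k) := by
  simp [lowPoly, Polynomial.map_sum]

theorem lowPoly_eval {R : Type} [CommRing R] (d : ℕ) (r : ℕ → R) (t : R) :
    (lowPoly d r).eval t = ∑ k ∈ Finset.range d, r k * t ^ k := by
  simp [lowPoly, Polynomial.eval_finsetSum]

theorem weierstrass_division_germ {f : anFun (n + 1)} {d : ℕ} {u : ℂ → ℂ} (hu : AnalyticAt ℂ u 0)
    (hu0 : u 0 ≠ 0) (hfu : ∀ᶠ t in 𝓝 (0 : ℂ), f.1 (Pi.single 0 t) = t ^ d * u t)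
    (g : anFun (n + 1)) : ∃ (q : anFun (n + 1)) (r : ℕ → anFun n),
      germ _ g = germ _ q * germ _ f + germ _ (polyFun (lowPoly d r)) := by
  obtain ⟨q, r, hq, hr, hru, h⟩ := weierstrass_division f.2 g.2 0 d hu hu0 hfu
  -- The remainders do not depend on the first variable, so restricting them to its zero value loses
  -- nothing.
  refine ⟨⟨q, hq⟩, fun k => ⟨fun x => r k (Fin.cons 0 x), (hr k).comp_of_eq analyticAt_consZero
    (by ext j; refine Fin.cases rfl (fun _ => rfl) j)⟩, ?_⟩
  rw [← map_mul, ← map_add, germ_eq_iff]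
  filter_upwards [h] with x hx
  change g.1 x = q x * f.1 x + (polyFun _).1 x
  rw [polyFun_apply, lowPoly_map, lowPoly_eval, hx]
  congr 1
  refine Finset.sum_congr rfl fun k _ => ?_
  congr 1
  change r k x = r k (Fin.cons 0 (Fin.tail x))
  rw [← hru k x 0]
  congr 1
  ext j
  refine Fin.cases ?_ (fun j => ?_) j
  · simp
  · simp [Fin.tail]

end BruceRoberts

end

/-! ### Elimination of one variable. -/

noncomputable section

open Polynomial

namespace BruceRoberts

variable {n : ℕ}

theorem polyFun_C (c : anFun n) : polyFun (C c) = tailFun c :=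
  eval₂_C _ _

theorem polyFun_X : polyFun (X : (anFun n)[X]) = coordFun 0 := eval₂_X _ _

theorem lowPoly_neg {R : Type} [CommRing R] (d : ℕ) (r : ℕ → R) :
    lowPoly d (fun k => -r k) = -lowPoly d r := by
  simp [lowPoly]

theorem tail_single_zero (t : ℂ) : Fin.tail (Pi.single 0 t : Fin (n + 1) → ℂ) = 0 := by
  ext j
  simp [Fin.tail]

theorem tendsto_single_zero :
    Tendsto (fun t : ℂ => (Pi.single 0 t : Fin (n + 1) → ℂ)) (𝓝 0) (𝓝 0) := by
  have h : Continuous fun t : ℂ => (Pi.single 0 t : Fin (n + 1) → ℂ) :=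
    continuous_single (A := fun _ => ℂ) 0
  simpa using h.tendsto 0

theorem eventually_forall_cons {P : (Fin (n + 1) → ℂ) → Prop} (hP : ∀ᶠ x in 𝓝 0, P x) :
    ∃ ε : ℝ, 0 < ε ∧ ε ≤ 1 ∧ ∀ x : Fin n → ℂ, ‖x‖ < ε → ∀ t : ℂ, ‖t‖ < ε → P (Fin.cons t x) := by
  obtain ⟨ε, hε, h⟩ := Metric.eventually_nhds_iff.1 hP
  refine ⟨min ε 1, lt_min hε one_pos, min_le_right _ _, fun x hx t ht => h ?_⟩
  rw [dist_zero_right, pi_norm_lt_iff hε]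
  intro j
  refine Fin.cases ?_ (fun j => ?_) j
  · exact ht.trans_le (min_le_left _ _)
  · exact ((norm_le_pi_norm x j).trans_lt hx).trans_le (min_le_left _ _)

/-- The common zeros of the resultants are isolated if those of the functions are. -/
theorem eventually_eq_zero_of_resultant {s d : ℕ} {a : ℕ → anFun n} (ha : ∀ k < d, (a k).1 0 = 0)
    {W : (anFun n)[X]} (hW : W = X ^ d + lowPoly d a) {g q : Fin s → anFun (n + 1)}
    {b : Fin s → ℕ → anFun n}
    (hg : ∀ j, germ _ (g j) = germ _ (q j) * germ _ (polyFun W) + germ _ (polyFun (lowPoly d (b j))))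
    (hV : ∀ᶠ x in 𝓝 0, (∀ j, (g j).1 x = 0) → x = 0) :
    ∀ᶠ x in 𝓝 (0 : Fin n → ℂ), (∀ l : Fin (d * s + 1),
      (resultant W (∑ j : Fin s, C (((l : ℕ) : anFun n) ^ (j : ℕ)) * lowPoly d (b j)) d d).1 x = 0) →
      x = 0 := by
  simp only [← map_mul, ← map_add, germ_eq_iff] at hg
  have hg' := eventually_all.2 hg
  obtain ⟨ε, hε, hε1, h⟩ := eventually_forall_cons (hg'.and hV)
  have h1 : ∀ᶠ x in 𝓝 (0 : Fin n → ℂ), ∑ k ∈ Finset.range d, ‖(a k).1 x‖ < ε ^ d := by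
    have hc : ContinuousAt (fun x : Fin n → ℂ => ∑ k ∈ Finset.range d, ‖(a k).1 x‖) 0 :=
      tendsto_finsetSum _ fun k _ => (a k).2.continuousAt.norm
    refine hc.eventually_lt continuousAt_const ?_
    rw [Finset.sum_eq_zero fun k hk => by rw [ha k (Finset.mem_range.1 hk), norm_zero]]
    positivity
  have h2 : ∀ᶠ x in 𝓝 (0 : Fin n → ℂ), ‖x‖ < ε := by
    filter_upwards [Metric.ball_mem_nhds (0 : Fin n → ℂ) hε] with x hx
    exact mem_ball_zero_iff.1 hx
  filter_upwards [h1, h2] with x hx1 hx2 hx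
  have hWx : W.map (evalAt x) = X ^ d + lowPoly d fun k => (a k).1 x := by
    rw [hW, Polynomial.map_add, Polynomial.map_pow, map_X, lowPoly_map]
    rfl
  have hmonic : (W.map (evalAt x)).Monic := by
    rw [hWx]
    exact monic_X_pow_add (lowPoly_degree_lt _ _)
  have hdeg : (W.map (evalAt x)).natDegree = d := by
    rw [hWx]
    rw [natDegree_add_eq_left_of_degree_lt, natDegree_X_pow]
    rw [degree_X_pow]
    exact lowPoly_degree_lt _ _
  obtain ⟨ρ, hρ, hR⟩ := exists_common_root hmonic hdeg
    (R := fun j => (lowPoly d (b j)).map (evalAt x))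
    (fun j => by
      rw [lowPoly_map]
      exact natDegree_le_of_degree_le (lowPoly_degree_lt _ _).le)
    (fun l hl => by
      have h3 := hx ⟨l, Finset.mem_range.1 hl⟩
      rw [← evalAt_apply, ← resultant_map_map] at h3
      have h4 : (∑ j : Fin s, C ((l : anFun n) ^ (j : ℕ)) * lowPoly d (b j)).map (evalAt x) =
          ∑ j : Fin s, C ((l : ℂ) ^ (j : ℕ)) * (lowPoly d (b j)).map (evalAt x) := by
        rw [Polynomial.map_sum]
        refine Finset.sum_congr rfl fun j _ => ?_
        rw [Polynomial.map_mul, map_C, map_pow, map_natCast]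
      exact h4 ▸ h3)
  -- The coefficients of W are small near 0, so its root is small too and (ρ, x) stays where the
  -- division identities and the isolation hypothesis hold.
  have hρε : ‖ρ‖ < ε := by
    refine norm_lt_of_root hε hε1 hx1 ?_
    rw [hWx, eval_add, eval_pow, eval_X, lowPoly_eval] at hρ
    exact hρ
  obtain ⟨h4, h5⟩ := h x hx2 ρ hρε
  have h6 := h5 fun j => by
    have h7 : (g j).1 (Fin.cons ρ x) = (q j).1 (Fin.cons ρ x) * (polyFun W).1 (Fin.cons ρ x) +
      (polyFun (lowPoly d (b j))).1 (Fin.cons ρ x) := h4 j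
    rw [h7, polyFun_apply, polyFun_apply, Fin.tail_cons, Fin.cons_zero, hρ, hR j, mul_zero, add_zero]
  ext j
  exact congrFun h6 j.succ

/-- The resultants of W with combinations of the remainders lie in the ideal and have an isolated
common zero in one variable fewer, so by induction every tail germ vanishing at 0 is in the radical.
Since W is z^d plus lower terms with such coefficients, z is in the radical as well, and division by
W reaches every germ vanishing at 0. -/
theorem mem_radical_of_weierstrass
    (ih : ∀ (s : ℕ) (c : Fin s → anFun n), (∀ᶠ x in 𝓝 0, (∀ j, (c j).1 x = 0) → x = 0) →
      ∀ e : O n, O.value e = 0 → e ∈ (Ideal.span (Set.range fun j => germ n (c j))).radical)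
    {s : ℕ} {g : Fin s → anFun (n + 1)} (hV : ∀ᶠ x in 𝓝 0, (∀ j, (g j).1 x = 0) → x = 0)
    {j₀ : Fin s} {d : ℕ} (hd : d ≠ 0) {u : ℂ → ℂ} (hu : AnalyticAt ℂ u 0) (hu0 : u 0 ≠ 0)
    (hfu : ∀ᶠ t in 𝓝 (0 : ℂ), (g j₀).1 (Pi.single 0 t) = t ^ d * u t)
    (f : O (n + 1)) (hf : O.value f = 0) :
    f ∈ (Ideal.span (Set.range fun j => germ _ (g j))).radical := by
  set I := Ideal.span (Set.range fun j => germ _ (g j))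
  have hgI : ∀ j, germ _ (g j) ∈ I := fun j => Ideal.subset_span ⟨j, rfl⟩
  obtain ⟨q₀, r₀, h₀⟩ := weierstrass_division_germ hu hu0 hfu (coordFun 0 ^ d)
  obtain ⟨W, hW⟩ : ∃ W : (anFun n)[X], W = X ^ d + lowPoly d fun k => -r₀ k := ⟨_, rfl⟩
  have hpW : germ _ (polyFun W) = germ _ q₀ * germ _ (g j₀) := by
    rw [hW, lowPoly_neg, map_add, map_neg, map_pow, polyFun_X, map_add, map_neg, h₀]
    ring
  have hWI : germ _ (polyFun W) ∈ I := hpW ▸ Ideal.mul_mem_left _ _ (hgI j₀)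
  -- On the axis the division reads t^d(1 - q₀u) = ∑ rₖ(0)t^k, with degree below d on the right, so
  -- all rₖ(0) vanish.
  have hr₀ : ∀ k < d, (r₀ k).1 0 = 0 := by
    rw [← map_mul, ← map_add, germ_eq_iff] at h₀
    have hq : ContinuousAt (fun t : ℂ => 1 - q₀.1 (Pi.single 0 t) * u t) 0 := by
      have h1 : ContinuousAt (fun t : ℂ => q₀.1 (Pi.single 0 t)) 0 :=
        ContinuousAt.comp_of_eq q₀.2.continuousAt
          (continuous_single (0 : Fin (n + 1))).continuousAt (by simp)
      exact continuousAt_const.sub (h1.mul hu.continuousAt)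
    refine eq_zero_of_pow_mul_eq_sum d hq (c := fun k => (r₀ k).1 0) ?_
    filter_upwards [(tendsto_single_zero.eventually h₀).filter_mono nhdsWithin_le_nhds,
      hfu.filter_mono nhdsWithin_le_nhds] with t ht ht'
    have h2 : (Pi.single 0 t : Fin (n + 1) → ℂ) 0 ^ d = q₀.1 (Pi.single 0 t) *
      (g j₀).1 (Pi.single 0 t) + (polyFun (lowPoly d r₀)).1 (Pi.single 0 t) := ht
    rw [ht', polyFun_apply, tail_single_zero, Pi.single_eq_same, lowPoly_map, lowPoly_eval] at h2
    change _ = _ + ∑ k ∈ Finset.range d, (r₀ k).1 0 * t ^ k at h2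
    linear_combination h2
  have ha : ∀ k < d, (-r₀ k).1 0 = 0 := fun k hk => by
    change -((r₀ k).1 0) = 0
    rw [hr₀ k hk, neg_zero]
  have hWaxis : ∀ᶠ t in 𝓝 (0 : ℂ), (polyFun W).1 (Pi.single 0 t) = t ^ d * (fun _ => 1) t := by
    refine Eventually.of_forall fun t => ?_
    rw [polyFun_apply, tail_single_zero, Pi.single_eq_same, hW, Polynomial.map_add,
      Polynomial.map_pow, map_X, lowPoly_map, eval_add, lowPoly_eval, Finset.sum_eq_zero]
    · simp
    · intro k hk
      rw [evalAt_apply, ha k (Finset.mem_range.1 hk), zero_mul]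
  have hdiv := weierstrass_division_germ (f := polyFun W) (u := fun _ => 1) analyticAt_const
    one_ne_zero hWaxis
  choose q b hgb using fun j => hdiv (g j)
  have hbI : ∀ j, germ _ (polyFun (lowPoly d (b j))) ∈ I := fun j => by
    have h1 : germ _ (polyFun (lowPoly d (b j))) =
        germ _ (g j) - germ _ (q j) * germ _ (polyFun W) := by
      rw [hgb j]; ring
    rw [h1]
    exact sub_mem (hgI j) (Ideal.mul_mem_left _ _ hWI)
  have hVc := eventually_eq_zero_of_resultant ha hW hgb hV
  have hrad := ih _ _ hVc
  -- Each resultant is a combination of W and the remainders, all of them in I, so the radical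
  -- membership known in n variables carries over.
  have hpull : ∀ e : O n, O.value e = 0 → tailPull e ∈ I.radical := by
    intro e he
    have h1 : Ideal.map (tailPull) (Ideal.span (Set.range
        fun l : Fin (d * s + 1) => germ n (resultant W
          (∑ j : Fin s, C (((l : ℕ) : anFun n) ^ (j : ℕ)) * lowPoly d (b j)) d d))) ≤ I := by
      rw [Ideal.map_span, Ideal.span_le]
      rintro _ ⟨_, ⟨l, rfl⟩, rfl⟩
      have hdegW : W.natDegree ≤ d := by
        rw [hW]
        exact natDegree_add_le_of_degree_le (natDegree_X_pow_le d)
          (natDegree_le_of_degree_le (lowPoly_degree_lt _ _).le)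
      have hdegG : (∑ j : Fin s, C (((l : ℕ) : anFun n) ^ (j : ℕ)) *
          lowPoly d (b j)).natDegree ≤ d :=
        natDegree_sum_le_of_forall_le _ _ fun j _ => (natDegree_C_mul_le _ _).trans
          (natDegree_le_of_degree_le (lowPoly_degree_lt _ _).le)
      obtain ⟨p, p', -, -, hp⟩ := exists_mul_add_mul_eq_C_resultant W _ hdegW hdegG (Or.inl hd)
      have h2 := congrArg (fun P => germ _ (polyFun P)) hp
      simp only [map_add, map_mul, polyFun_C, map_sum] at h2
      simp only [SetLike.mem_coe, tailPull_germ]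
      rw [← h2]
      exact add_mem (Ideal.mul_mem_right _ _ hWI) (Ideal.mul_mem_right _ _
        (sum_mem fun j _ => Ideal.mul_mem_left _ _ (hbI j)))
    exact Ideal.radical_mono h1 (Ideal.map_radical_le _ (Ideal.mem_map_of_mem _ (hrad e he)))
  have hz : coord (0 : Fin (n + 1)) ∈ I.radical := by
    have h1 : coord (0 : Fin (n + 1)) ^ d ∈ I.radical := by
      have h2 : coord (0 : Fin (n + 1)) ^ d =
          germ _ (polyFun W) + germ _ (polyFun (lowPoly d r₀)) := by
        rw [hpW, ← h₀, map_pow]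
        rfl
      rw [h2]
      refine add_mem (Ideal.le_radical hWI) ?_
      rw [lowPoly, map_sum, map_sum]
      refine sum_mem fun k hk => ?_
      rw [map_mul, map_mul, polyFun_C, ← tailPull_germ]
      exact Ideal.mul_mem_right _ _ (hpull _ (hr₀ k (Finset.mem_range.1 hk)))
    exact Ideal.mem_radical_of_pow_mem h1
  obtain ⟨f, rfl⟩ := germ_surjective f
  obtain ⟨q', c, hc⟩ := hdiv f
  rw [hc]
  refine add_mem (Ideal.mul_mem_left _ _ (Ideal.le_radical hWI)) ?_
  rw [lowPoly, map_sum, map_sum]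
  refine sum_mem fun k hk => ?_
  rw [map_mul, map_mul, polyFun_C, ← tailPull_germ, map_pow, map_pow, polyFun_X]
  rcases Nat.eq_zero_or_pos k with rfl | hk'
  · refine Ideal.mul_mem_right _ _ (hpull _ ?_)
    have h1 := congrArg O.value hc
    have h2 : O.value (germ _ (polyFun W)) = 0 := by
      have h3 := hWaxis.self_of_nhds
      rw [Pi.single_zero, zero_pow hd, zero_mul] at h3
      exact h3
    rw [hf, map_add, map_mul, h2, mul_zero, zero_add, value_germ, polyFun_apply, lowPoly_map,
      lowPoly_eval, Finset.sum_eq_single_of_mem 0 hk] at h1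
    · rw [pow_zero, mul_one] at h1
      exact h1.symm
    · intro j _ hj
      simp [hj]
  · exact Ideal.mul_mem_left _ _ (Ideal.pow_mem_of_mem _ hz _ hk')

end BruceRoberts

end

/-! ### Rückert's Nullstellensatz for an isolated zero. -/

noncomputable section

namespace BruceRoberts

variable {n : ℕ}

/-- Take p with G(p) ≠ 0 in a ball on which G is analytic. By the identity theorem G is not
identically zero near 0 on the line through p, so it has finite order there; L carries the first
axis to that line. -/
theorem exists_line_order {G : (Fin (n + 1) → ℂ) → ℂ} (hG : AnalyticAt ℂ G 0) (hG0 : G 0 = 0)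
    (hne : ¬∀ᶠ x in 𝓝 0, G x = 0) :
    ∃ (L : (Fin (n + 1) → ℂ) ≃L[ℂ] (Fin (n + 1) → ℂ)) (d : ℕ) (u : ℂ → ℂ), d ≠ 0 ∧
      AnalyticAt ℂ u 0 ∧ u 0 ≠ 0 ∧ ∀ᶠ t in 𝓝 (0 : ℂ), G (L (Pi.single 0 t)) = t ^ d * u t := by
  obtain ⟨r, hr, hGr⟩ := Metric.eventually_nhds_iff_ball.1 hG.eventually_analyticAt
  obtain ⟨p, hp, hpr⟩ := ((not_eventually.1 hne).and_eventually (Metric.ball_mem_nhds 0 hr)).exists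
  have hp0 : p ≠ 0 := by rintro rfl; exact hp hG0
  have he : (Pi.single 0 1 : Fin (n + 1) → ℂ) ≠ 0 := by simp
  obtain ⟨L, hL⟩ := SeparatingDual.exists_continuousLinearEquiv_apply_eq (R := ℂ) he hp0
  have hLt : ∀ t : ℂ, L (Pi.single 0 t) = t • p := fun t => by
    rw [← hL, ← map_smul, ← Pi.single_smul, smul_eq_mul, mul_one]
  let l : ℂ →L[ℂ] (Fin (n + 1) → ℂ) := (ContinuousLinearMap.id ℂ ℂ).smulRight p
  have hl : ∀ t, l t = t • p := fun t => rfl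
  let U : Set ℂ := l ⁻¹' Metric.ball 0 r
  have hU : IsPreconnected U :=
    (((convex_ball (0 : Fin (n + 1) → ℂ) r).is_linear_preimage
      (IsLinearMap.mk (map_add l) fun c x => by
        rw [hl, hl, smul_assoc])).isPreconnected)
  have h0 : (0 : ℂ) ∈ U := by simp [U, hr]
  have h1 : (1 : ℂ) ∈ U := by
    change l 1 ∈ Metric.ball (0 : Fin (n + 1) → ℂ) r
    rw [hl, one_smul]
    exact hpr
  have hA : AnalyticOnNhd ℂ (fun t => G (l t)) U := fun t ht =>
    (hGr (l t) ht).comp (l.analyticAt t)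
  have hnz : ¬∀ᶠ t in 𝓝 (0 : ℂ), G (l t) = 0 := fun h => by
    have h2 := hA.eqOn_zero_of_preconnected_of_eventuallyEq_zero hU h0 h h1
    change G (l 1) = 0 at h2
    rw [hl, one_smul] at h2
    exact hp h2
  obtain ⟨d, u, hu, hu0, hdu⟩ := ((hA 0 h0).exists_eventuallyEq_pow_smul_nonzero_iff).2 hnz
  refine ⟨L, d, u, ?_, hu, hu0, ?_⟩
  · rintro rfl
    have h2 := hdu.self_of_nhds
    rw [map_zero, hG0, pow_zero, one_smul] at h2
    exact hu0 h2.symm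
  · filter_upwards [hdu] with t ht
    rw [hLt, ← hl, ht, sub_zero, smul_eq_mul]

/-- Rückert's Nullstellensatz for an isolated common zero. -/
theorem mem_radical_of_isolated_zero : ∀ {n s : ℕ} (g : Fin s → anFun n),
    (∀ᶠ x in 𝓝 0, (∀ j, (g j).1 x = 0) → x = 0) →
    ∀ f : O n, O.value f = 0 → f ∈ (Ideal.span (Set.range fun j => germ n (g j))).radical := by
  intro n
  induction n with
  | zero =>
    intro s g _ f hf
    obtain ⟨f, rfl⟩ := germ_surjective f
    have h : germ 0 f = germ 0 0 := germ_eq_iff.2 (Eventually.of_forall fun x => by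
      rw [Subsingleton.elim x 0]
      exact hf)
    rw [h, map_zero]
    exact zero_mem _
  | succ n ih =>
    intro s g hV f hf
    by_cases h0 : ∀ j, (g j).1 0 = 0
    swap
    · push Not at h0
      obtain ⟨j, hj⟩ := h0
      have hmem : germ _ (g j) ∈ Ideal.span (Set.range fun j => germ _ (g j)) :=
        Ideal.subset_span ⟨j, rfl⟩
      rw [Ideal.eq_top_of_isUnit_mem _ hmem (isUnit_of_value_ne_zero hj), Ideal.radical_top]
      trivial
    -- If every germ vanished identically, all nearby points would be common zeros; in positive
    -- dimension the origin is not isolated, a contradiction.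
    obtain ⟨j₀, hj₀⟩ : ∃ j, ¬∀ᶠ x in 𝓝 0, (g j).1 x = 0 := by
      by_contra! h
      have h1 : ∀ᶠ x in 𝓝[≠] (0 : Fin (n + 1) → ℂ), False := by
        filter_upwards [(hV.and (eventually_all.2 h)).filter_mono nhdsWithin_le_nhds,
          self_mem_nhdsWithin] with x hx hx'
        exact hx' (hx.1 hx.2)
      exact h1.exists.elim fun _ h => h
    obtain ⟨L, d, u, hd, hu, hu0, hdu⟩ := exists_line_order (g j₀).2 (h0 j₀) hj₀
    have hL : AnalyticAt ℂ L 0 := L.analyticAt 0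
    have hL' : AnalyticAt ℂ L.symm 0 := L.symm.analyticAt 0
    have hVL : ∀ᶠ x in 𝓝 0, (∀ j, (pullFun L hL (map_zero L) (g j)).1 x = 0) → x = 0 := by
      have ht : Tendsto L (𝓝 0) (𝓝 0) := by simpa using L.continuous.tendsto 0
      filter_upwards [ht.eventually hV] with x hx h
      exact (map_eq_zero_iff L L.injective).1 (hx h)
    have hfL : O.value (pull L hL (map_zero L) f) = 0 := by
      obtain ⟨f, rfl⟩ := germ_surjective f
      rw [pull_germ, value_germ, ← hf, value_germ]
      exact congrArg f.1 (map_zero L)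
    have hmem := mem_radical_of_weierstrass (fun s c => ih c) hVL (j₀ := j₀) hd hu hu0 hdu _ hfL
    have hinv : ∀ e, pull L.symm hL' (map_zero L.symm) (pull L hL (map_zero L) e) = e := by
      intro e
      obtain ⟨e, rfl⟩ := germ_surjective e
      rw [pull_germ, pull_germ]
      congr 1
      exact Subtype.ext (funext fun x => congrArg e.1 (L.apply_symm_apply x))
    have h1 := Ideal.map_radical_le (pull L.symm hL' (map_zero L.symm))
      (Ideal.mem_map_of_mem _ hmem)
    rw [hinv] at h1
    refine Ideal.radical_mono ?_ h1
    rw [Ideal.map_span, Ideal.span_le]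
    rintro _ ⟨_, ⟨j, rfl⟩, rfl⟩
    simp only [← pull_germ, hinv]
    exact Ideal.subset_span ⟨j, rfl⟩

end BruceRoberts

end

/-! ### Finite codimension, maximal minors and exactness modulo I_X. -/

noncomputable section

namespace BruceRoberts

variable {n k : ℕ}

theorem mem_radical_of_isolated_zero_of_finite {ι : Type} [Finite ι] (g : ι → anFun n)
    (h : ∀ᶠ x in 𝓝 0, (∀ j, (g j).1 x = 0) → x = 0) (f : O n) (hf : O.value f = 0) :
    f ∈ (Ideal.span (Set.range fun j => germ n (g j))).radical := by
  obtain ⟨s, ⟨e⟩⟩ := Finite.exists_equiv_fin ι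
  have h1 := mem_radical_of_isolated_zero (fun j => g (e.symm j))
    (h.mono fun x hx h => hx fun j => by simpa using h (e j)) f hf
  have h2 : (fun j => germ n (g (e.symm j))) = (fun j => germ n (g j)) ∘ e.symm := rfl
  rwa [h2, e.symm.surjective.range_comp] at h1

theorem value_algebraMap (c : ℂ) : O.value (algebraMap ℂ (O n) c) = c := by
  rw [Algebra.algebraMap_eq_smul_one]
  change c • (1 : ℂ) = c
  simp

open Polynomial in
/-- In an ideal of finite codimension some power of every nonunit lies. -/
theorem exists_pow_mem_of_finite (J : Ideal (O n)) [Module.Finite ℂ (O n ⧸ J)] {f : O n}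
    (hf : O.value f = 0) : ∃ N, f ^ N ∈ J := by
  obtain ⟨p, hp, hp0⟩ := Algebra.IsIntegral.isIntegral (R := ℂ) (Ideal.Quotient.mk J f)
  -- Write the integral equation as X^m q with q(0) ≠ 0. Then q(f) has nonzero value at 0 and is a
  -- unit, which leaves f^m in J.
  obtain ⟨q, hq, hq0⟩ := exists_eq_pow_rootMultiplicity_mul_and_not_dvd p hp.ne_zero 0
  refine ⟨p.rootMultiplicity 0, ?_⟩
  have h1 : aeval f p ∈ J := by
    rw [← Ideal.Quotient.eq_zero_iff_mem, ← hp0, aeval_def, hom_eval₂]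
    rfl
  have h2 : IsUnit (aeval f q) := by
    refine isUnit_of_value_ne_zero ?_
    have h3 : O.value.comp (algebraMap ℂ (O n)) = RingHom.id ℂ := RingHom.ext (value_algebraMap (n := n))
    rw [aeval_def, hom_eval₂, h3, hf, eval₂_id]
    rwa [dvd_iff_isRoot] at hq0
  rw [hq, C_0, sub_zero, map_mul, map_pow, aeval_X] at h1
  exact (Ideal.mul_unit_mem_iff_mem J h2).1 h1

/-- For a right inverse B, expanding det(AB) = 1 multilinearly in the columns of A writes 1 as a
combination of the maximal minors. -/
theorem exists_minor_ne_zero {r : ℕ} {K : Type} [Field K] (A : Matrix (Fin r) (Fin n) K)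
    (hA : Function.Surjective A.mulVec) : ∃ I : Fin r → Fin n, (A.submatrix id I).det ≠ 0 := by
  classical
  by_contra! h
  choose b hb using fun j : Fin r => hA (Pi.single j 1)
  have h1 : A * Matrix.of (fun i j => b j i) = 1 := by
    ext i j
    have := congrFun (hb j) i
    rw [Matrix.one_apply, Matrix.mul_apply]
    rw [Pi.single_apply] at this
    exact this
  have h2 : (1 : K) = 0 := by
    rw [← Matrix.det_one (n := Fin r), ← h1, ← Matrix.det_transpose]
    have h3 : (A * Matrix.of (fun i j => b j i)).transpose =
        fun j => ∑ i, b j i • A.transpose i := by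
      ext j i
      simp [Matrix.mul_apply, mul_comm]
    rw [h3]
    change (Matrix.detRowAlternating : (Fin r → K) [⋀^Fin r]→ₗ[K] K).toMultilinearMap _ = 0
    rw [MultilinearMap.map_sum]
    refine Finset.sum_eq_zero fun I _ => ?_
    rw [MultilinearMap.map_smul_univ]
    have h4 := h I
    rw [← Matrix.det_transpose] at h4
    exact smul_eq_zero_of_right _ h4
  exact one_ne_zero h2

theorem mem_ideal_smul_top_pi {R : Type} [CommRing R] {r : ℕ} {I : Ideal R} {y : Fin r → R}
    (h : ∀ i, y i ∈ I) : y ∈ I • (⊤ : Submodule R (Fin r → R)) := by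
  rw [pi_eq_sum_univ' y]
  exact Submodule.sum_mem _ fun i _ => Submodule.smul_mem_smul (h i) trivial

/-- The maximal minors of a system of 1-forms annihilate the homology of its Buchsbaum–Rim
complex up to powers. -/
theorem minor_kills {r : ℕ} (M : Matrix (Fin r) (Fin n) (O n)) (I : Fin r → Fin n) :
    Cplx.Kills ((M.submatrix id I).det ^ (r + 1))
      (buchsbaumRim fun i => OneForm.eval (M i)) := by
  refine buchsbaumRim_kills _
    -- The columns of the adjugate, placed at the positions selected by I, are sent by M to the
    -- minor times the standard basis vectors.
    (fun j => ∑ l, (M.submatrix id I).adjugate l j • Pi.single (I l) 1) fun i j => ?_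
  have h := congrFun (congrFun (M.submatrix id I).mul_adjugate i) j
  rw [Matrix.mul_apply, Matrix.smul_apply, Matrix.one_apply, smul_eq_mul, mul_ite, mul_one,
    mul_zero] at h
  rw [← h, map_sum]
  refine Finset.sum_congr rfl fun l _ => ?_
  rw [map_smul, smul_eq_mul, mul_comm]
  congr 1
  change ∑ m, M i m * (Pi.single (I l) 1 : Fin n → O n) m = M i (I l)
  simp [Pi.single_apply]

/-- The depth count closes exactly: the Buchsbaum–Rim length n - (k+1) + 1 plus the k cones equals
n, the length of the coordinate sequence. -/
theorem exactMod_of_radical (hkn : k < n) (φ : Fin k → O n)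
    (M : Matrix (Fin (k + 1)) (Fin n) (O n))
    (h : ∀ i, coord i ∈ (Ideal.span (Set.range φ) ⊔
      Ideal.span (Set.range fun I : Fin (k + 1) → Fin n => (M.submatrix id I).det)).radical) :
    (buchsbaumRim fun i => OneForm.eval (M i)).ExactMod (idealX φ) := by
  refine Cplx.exactMod_span (s := coordSeq n) k φ _ (n - (k + 1) + 1)
    (buchsbaumRim_subsingleton _ (by omega)) (fun i => ?_) (fun j hj => ?_)
  · rw [show n - (k + 1) + 1 + k = n by omega]
    exact buchsbaumRim_weaklyRegular _ weaklyRegular_coordSeq i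
  · have hjn : j < n := by omega
    rw [coordSeq, dif_pos hjn]
    rw [← Ideal.radical_idem]
    refine Ideal.radical_mono (sup_le (le_sup_right.trans Ideal.le_radical) ?_) (h ⟨j, hjn⟩)
    rw [Ideal.span_le]
    rintro _ ⟨I, rfl⟩
    exact ⟨k + 1 + 1, Ideal.mem_sup_left (minor_kills M I)⟩

end BruceRoberts

end

/-! ### Application to the singularity and the form ω. -/

noncomputable section

namespace BruceRoberts

variable {n k : ℕ}

/-- The partial derivative of a holomorphic function. -/
def partialFun (j : Fin n) (f : anFun n) : anFun n :=
  ⟨fun x => fderiv ℂ f.1 x (Pi.single j 1),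
    ((ContinuousLinearMap.apply ℂ ℂ (Pi.single j 1 : Fin n → ℂ)).analyticAt _).comp f.2.fderiv⟩

/-- The coefficients of `ω, dφ₁, …, dφₖ`. -/
def formMatrix (ω : OneForm n) (φ : Fin k → O n) : Matrix (Fin (k + 1)) (Fin n) (O n) :=
  Matrix.of (Fin.cons ω fun i => differential (φ i))

/-- Solve for the last k components by surjectivity of the derivative, then correct the first along
v, which the derivative kills and the form does not. -/
theorem surjective_mulVec_of_section {f : Fin k → anFun n} {w : Fin n → anFun n}
    {x v : Fin n → ℂ} (hf : ∀ i, DifferentiableAt ℂ (f i).1 x)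
    (hs : Function.Surjective (fderiv ℂ (fun x i => (f i).1 x) x))
    (hv : ∀ i, ∑ l, (partialFun l (f i)).1 x * v l = 0) (hw : ∑ l, (w l).1 x * v l ≠ 0) :
    Function.Surjective (Matrix.mulVec (Matrix.of (Fin.cons (fun l => (w l).1 x)
      fun i l => (partialFun l (f i)).1 x : Fin (k + 1) → Fin n → ℂ))) := by
  have hd : ∀ u i, fderiv ℂ (fun x i => (f i).1 x) x u i = ∑ l, (partialFun l (f i)).1 x * u l := by
    intro u i
    rw [fderiv_pi hf, ContinuousLinearMap.pi_apply,
      ← ContinuousLinearMap.coe_coe, LinearMap.pi_apply_eq_sum_univ]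
    refine Finset.sum_congr rfl fun l _ => ?_
    have hl : (fun j => if l = j then (1 : ℂ) else 0) = Pi.single l 1 := by
      ext m
      simp [Pi.single_apply, eq_comm]
    rw [hl]
    exact mul_comm _ _
  intro y
  obtain ⟨u, hu⟩ := hs (Fin.tail y)
  refine ⟨u + ((y 0 - ∑ l, (w l).1 x * u l) / ∑ l, (w l).1 x * v l) • v, ?_⟩
  rw [Matrix.mulVec_add, Matrix.mulVec_smul]
  ext i
  refine Fin.cases ?_ (fun i => ?_) i
  · change ∑ l, (w l).1 x * u l + _ * ∑ l, (w l).1 x * v l = y 0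
    rw [div_mul_cancel₀ _ hw]
    ring
  · change ∑ l, (partialFun l (f i)).1 x * u l + _ * ∑ l, (partialFun l (f i)).1 x * v l = y i.succ
    rw [hv, mul_zero, add_zero, ← hd, hu]
    rfl

theorem eventually_of_mem_logFields {f : Fin k → anFun n} {X : Fin n → anFun n}
    (h : (fun l => germ n (X l)) ∈ logFields fun i => germ n (f i)) (i : Fin k) :
    ∀ᶠ x in 𝓝 0, (∀ j, (f j).1 x = 0) → ∑ l, (partialFun l (f i)).1 x * (X l).1 x = 0 := by
  obtain ⟨c, hc⟩ := (Ideal.mem_span_range_iff_exists_fun).1 (h _ (Ideal.subset_span ⟨i, rfl⟩))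
  choose c' hc' using fun j => germ_surjective (c j)
  have h1 : germ n (∑ j, c' j * f j) = germ n (∑ l, partialFun l (f i) * X l) := by
    rw [map_sum, map_sum]
    simp only [map_mul, hc']
    exact hc
  filter_upwards [germ_eq_iff.1 h1] with x hx hfx
  change evalAt x _ = evalAt x _ at hx
  simp only [map_sum, map_mul, evalAt_apply, hfx, mul_zero, Finset.sum_const_zero] at hx
  exact hx.symm

theorem eventually_of_eval_eq {w X : Fin n → anFun n} {i : Fin n} {N : ℕ}
    (h : OneForm.eval (fun l => germ n (w l)) (fun l => germ n (X l)) = coord i ^ N) :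
    ∀ᶠ x in 𝓝 0, ∑ l, (w l).1 x * (X l).1 x = x i ^ N := by
  have h1 : germ n (∑ l, w l * X l) = germ n (coordFun i ^ N) := by
    rw [map_sum, map_pow]
    simp only [map_mul]
    exact h
  filter_upwards [germ_eq_iff.1 h1] with x hx
  change evalAt x (∑ l, w l * X l) = evalAt x (coordFun i ^ N) at hx
  simp only [map_sum, map_mul, map_pow, evalAt_apply] at hx
  exact hx

/-- This is where finiteness of μ_BR(ω, X) meets the isolated singularity: at a nonzero point of X,
fields realising powers of the coordinates as values of ω show that ω is independent of the dφᵢ, so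
some minor is nonzero there. -/
theorem coord_mem_radical {φ : Fin k → O n} (hφ : IsICIS φ) (ω : OneForm n)
    (hω : bruceRobertsNumber ω φ < ⊤) (i : Fin n) :
    coord i ∈ (Ideal.span (Set.range φ) ⊔ Ideal.span (Set.range
      fun I : Fin (k + 1) → Fin n => ((formMatrix ω φ).submatrix id I).det)).radical := by
  obtain ⟨F, hF, -, hsurj⟩ := hφ.isolated
  obtain ⟨f, rfl, rfl⟩ : ∃ f : Fin k → anFun n, φ = (fun i => germ n (f i)) ∧
      F = fun x i => (f i).1 x := by
    have hFa : ∀ i, AnalyticAt ℂ (fun x => F x i) 0 := fun i => by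
      obtain ⟨g, hg⟩ := germ_surjective (φ i)
      have h1 : Germ.ofFun (l := 𝓝 (0 : Fin n → ℂ)) (fun x => F x i) =
        Germ.ofFun g.1 := (hF i).trans (congrArg Subtype.val hg.symm)
      exact g.2.congr (Germ.coe_eq.1 h1).symm
    exact ⟨fun i => ⟨fun x => F x i, hFa i⟩, funext fun i => Subtype.ext (hF i).symm, rfl⟩
  choose w hw using fun l => germ_surjective (ω l)
  obtain rfl : ω = fun l => germ n (w l) := funext fun l => (hw l).symm
  have hfin : Module.Finite ℂ (O n ⧸ evalLog (fun l => germ n (w l)) fun i => germ n (f i)) :=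
    Module.rank_lt_aleph0_iff.1 (Cardinal.toENat_lt_top.1 hω)
  have hX : ∀ i : Fin n, ∃ (N : ℕ) (X : Fin n → anFun n),
      (fun l => germ n (X l)) ∈ (logFields fun i => germ n (f i)) ∧
      OneForm.eval (fun l => germ n (w l)) (fun l => germ n (X l)) = coord i ^ N := by
    intro i
    obtain ⟨N, ξ, hξ, h⟩ := exists_pow_mem_of_finite
      (evalLog (fun l => germ n (w l)) fun i => germ n (f i)) (f := coord i) rfl
    choose X hX using fun l => germ_surjective (ξ l)
    obtain rfl : ξ = fun l => germ n (X l) := funext fun l => (hX l).symm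
    exact ⟨N, X, hξ, h⟩
  choose N X hXlog hXω using hX
  let A : Matrix (Fin (k + 1)) (Fin n) (anFun n) := Matrix.of (Fin.cons w fun i l => partialFun l (f i))
  have hA : (formMatrix (fun l => germ n (w l)) fun i => germ n (f i)) =
      A.map (germ n) := by
    ext i l
    refine Fin.cases ?_ (fun i => ?_) i <;> rfl
  have hAx : ∀ x, A.map (evalAt x) = Matrix.of (Fin.cons (fun l => (w l).1 x)
      fun i l => (partialFun l (f i)).1 x) := by
    intro x
    ext i l
    refine Fin.cases ?_ (fun i => ?_) i <;> rfl
  let g : Fin k ⊕ (Fin (k + 1) → Fin n) → anFun n :=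
    Sum.elim f fun I => (A.submatrix id I).det
  have hg : ∀ᶠ x in 𝓝 0, (∀ j, (g j).1 x = 0) → x = 0 := by
    filter_upwards [eventually_nhdsWithin_iff.1 hsurj,
      eventually_all.2 fun i => eventually_all.2 fun j => eventually_of_mem_logFields (hXlog i) j,
      eventually_all.2 fun i => eventually_of_eval_eq (hXω i),
      eventually_all.2 fun j => (f j).2.eventually_analyticAt] with x h1 h2 h3 h4 hx
    by_contra hx0
    have hfx : ∀ j, (f j).1 x = 0 := fun j => hx (Sum.inl j)
    obtain ⟨i, hi⟩ := Function.ne_iff.1 hx0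
    obtain ⟨I, hI⟩ := exists_minor_ne_zero _ (surjective_mulVec_of_section
      (fun j => (h4 j).differentiableAt) (h1 hx0 (funext hfx)) (fun j => h2 i j hfx)
      ((h3 i).symm ▸ pow_ne_zero _ hi))
    refine hI ?_
    rw [← hAx]
    have h5 : evalAt x (A.submatrix id I).det = 0 := hx (Sum.inr I)
    rw [RingHom.map_det] at h5
    exact h5
  refine Ideal.radical_mono ?_ (mem_radical_of_isolated_zero_of_finite g hg (coord i) rfl)
  rw [Ideal.span_le]
  rintro _ ⟨j | I, rfl⟩
  · exact Ideal.mem_sup_left (Ideal.subset_span ⟨j, rfl⟩)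
  · refine Ideal.mem_sup_right (Ideal.subset_span ⟨I, ?_⟩)
    change _ = germ n (A.submatrix id I).det
    rw [RingHom.map_det, hA]
    rfl

/-- Exactness modulo I_X splits ξ into a splice image, annihilated by every row and so by all dφᵢ,
and a field with coefficients in I_X. -/
theorem mem_trivialFields_of_eval_mem (hkn : k < n) {φ : Fin k → O n} (hφ : IsICIS φ)
    {ω : OneForm n} (hω : bruceRobertsNumber ω φ < ⊤) {ξ : VectorField n} (hξ : ξ ∈ logFields φ)
    (h : ω.eval ξ ∈ idealX φ) : ξ ∈ trivialFields φ := by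
  obtain ⟨w, hw⟩ := exactMod_of_radical hkn φ (formMatrix ω φ) (coord_mem_radical hφ ω hω) ξ
    (mem_ideal_smul_top_pi fun i => by
      refine Fin.cases ?_ (fun i => ?_) i
      · exact h
      · exact hξ _ (Ideal.subset_span ⟨i, rfl⟩))
  refine Submodule.mem_sup.2 ⟨_, ?_, _, hw, add_sub_cancel _ _⟩
  exact LinearMap.mem_ker.2 (funext fun i => apply_brSplice (fun i => OneForm.eval (formMatrix ω φ i)) i.succ w)

/-- If ω(ξ) = ω(η) with η trivial, then ω(ξ - η) = 0 lies in I_X, so ξ - η is trivial and hence ξ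
is. -/
theorem bijective_evalMapBar {φ : Fin k → O n} {ω : OneForm n}
    (h : ∀ ξ ∈ logFields φ, ω.eval ξ ∈ idealX φ → ξ ∈ trivialFields φ) :
    Function.Bijective (evalMapBar ω φ) := by
  constructor
  · refine (injective_iff_map_eq_zero _).2 fun a ha => ?_
    obtain ⟨ξ, rfl⟩ := Submodule.Quotient.mk_surjective _ a
    obtain ⟨η, hη, hηξ⟩ := (Submodule.Quotient.mk_eq_zero _).1 ha
    refine (Submodule.Quotient.mk_eq_zero _).2 ?_
    change ξ.1 ∈ trivialFields φ
    rw [← sub_add_cancel ξ.1 η]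
    refine add_mem (h _ (sub_mem ξ.2 (trivialFields_le_logFields φ hη)) ?_) hη
    have h1 : ω.eval η = ω.eval ξ.1 := hηξ
    rw [map_sub, h1, sub_self]
    exact zero_mem _
  · intro b
    obtain ⟨⟨_, ξ, hξ, rfl⟩, rfl⟩ := Submodule.Quotient.mk_surjective _ b
    exact ⟨Submodule.Quotient.mk ⟨ξ, hξ⟩, rfl⟩

end BruceRoberts

end

theorem mainTheorem3 {n k : ℕ} (hkn : k < n)
    (φ : Fin k → BruceRoberts.O n) (hφ : BruceRoberts.IsICIS φ)
    (ω : BruceRoberts.OneForm n) (hω : BruceRoberts.bruceRobertsNumber ω φ < ⊤) :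
    (∀ ξ ∈ BruceRoberts.logFields φ, ω.eval ξ ∈ BruceRoberts.idealX φ →
      ξ ∈ BruceRoberts.trivialFields φ) ∧
    Function.Bijective (BruceRoberts.evalMapBar ω φ) :=
  have h := fun ξ hξ hξω => BruceRoberts.mem_trivialFields_of_eval_mem hkn hφ hω (ξ := ξ) hξ hξω
  ⟨h, BruceRoberts.bijective_evalMapBar h⟩
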